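/- Let $E=\mathbb{C}/\Lambda$ be a complex elliptic curve, where $\Lambda\subset\mathbb{C}$ is a lattice, and let $g\ge 1$. Let $$X=\{(x_1,\dots,x_{g+1})\in E^{g+1} : x_1+\cdots+x_{g+1}=0\},$$ identified with $E^g$ by forgetting the last coordinate. On $E^g$ let $\pi_i$ be the $i$-th projection, let $\Sigma:E^g\to E$ be the sum morphism $(x_1,\dots,x_g)\mapsto x_1+\cdots+x_g$, and consider the polarization given by the effective divisor $$\Xi_g:=\sum_{i=1}^g\pi_i^*([0])+\ker(\Sigma).$$ Let $K(\Xi_g)$ be the group of all $x$ such that $t_x^*\mathcal{O}(\Xi_g)\cong\mathcal{O}(\Xi_g)$, where $t_x$ is the translation by $x$. Then, as a subgroup of $E^g$, $$K(\Xi_g)=\{(x,\dots,x) : x\in E[g+1]\}\subset E^g,$$ and, under the identification $X\cong E^g$, as a subgroup of $X$, $$K(\Xi_g)=\{(x,\dots,x) : x\in E[g+1]\}\subset X\subset E^{g+1}.$$ Hence $\Xi_g$ has type $(d_1,\dots,d_g)=(1,\dots,1,g+1)$; that is, $d_i>0$, $d_i\mid d_j$ for $i\le j$, and $K(\Xi_g)\cong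 Z\oplus Z$ with $Z=\bigoplus_{i=1}^g\mathbb{Z}/d_i\mathbb{Z}$. -/

import Mathlib

open TopologicalSpace

noncomputable section

namespace EllPow

/-- The complex elliptic curve `E = ℂ / Λ`, where `Λ = ℤ ω₁ + ℤ ω₂` is the lattice of a pair of
`ℝ`-linearly independent periods. -/
abbrev Curve (L : PeriodPair) : Type := ℂ ⧸ L.lattice

/-- The self-product `E ^ g`, a complex abelian variety with its product topology and group law. -/
abbrev Pow (L : PeriodPair) (g : ℕ) : Type := Fin g → Curve L

variable {L : PeriodPair} {g : ℕ}

/-- The universal covering `ℂ ^ g → E ^ g`. -/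
def proj (L : PeriodPair) (g : ℕ) (z : Fin g → ℂ) : Pow L g := fun i => L.lattice.mkQ (z i)

/-- `f` is a holomorphic function on the open subset `U` of `E ^ g`: since the complex structure on
`E ^ g` is the one for which `ℂ ^ g → E ^ g` is a local biholomorphism, this says that the pullback
of `f` is holomorphic on the preimage of `U`. The values of `f` outside `U` are irrelevant. -/
def HolOn (U : Opens (Pow L g)) (f : Pow L g → ℂ) : Prop :=
  DifferentiableOn ℂ (f ∘ proj L g) (proj L g ⁻¹' U)

theorem HolOn.mono {U V : Opens (Pow L g)} (h : V ≤ U) {f : Pow L g → ℂ} (hf : HolOn U f) :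
    HolOn V f :=
  DifferentiableOn.mono hf fun _ hz => h hz

theorem HolOn.mul {U : Opens (Pow L g)} {f k : Pow L g → ℂ} (hf : HolOn U f) (hk : HolOn U k) :
    HolOn U (f * k) :=
  DifferentiableOn.mul hf hk

/-! ### Effective divisors and their local equations -/

/-- `f` is an equation on the open set `V` of the hypersurface `Z` (with its reduced structure):
`f` is holomorphic on `V` and generates the ideal sheaf of `Z` over `V`, i.e. `f` vanishes on `Z`,
and every holomorphic function on an open `W ⊆ V` that vanishes on `Z` is a multiple of `f`. -/
def IsEquation (Z : Set (Pow L g)) (V : Opens (Pow L g)) (f : Pow L g → ℂ) : Prop :=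
  HolOn V f ∧ (∀ p ∈ V, p ∈ Z → f p = 0) ∧
    ∀ W : Opens (Pow L g), W ≤ V → ∀ h : Pow L g → ℂ, HolOn W h →
      (∀ p ∈ W, p ∈ Z → h p = 0) →
      ∃ k : Pow L g → ℂ, HolOn W k ∧ ∀ p ∈ W, h p = f p * k p

/-- Effective divisors on `E ^ g`: formal sums, with coefficients in `ℕ`, of hypersurfaces. -/
abbrev EffDivisor (L : PeriodPair) (g : ℕ) : Type := Set (Pow L g) →₀ ℕ

/-- The support of an effective divisor. -/
def supp (D : EffDivisor L g) : Set (Pow L g) := ⋃ Z ∈ D.support, Z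

/-- `f` is a local equation on `V` of `D = ∑ n_Z Z`: it is `∏ (f_Z) ^ n_Z` with `f_Z` an equation
of `Z` on `V`. -/
def IsLocalEquation (D : EffDivisor L g) (V : Opens (Pow L g)) (f : Pow L g → ℂ) : Prop :=
  ∃ φ : Set (Pow L g) → Pow L g → ℂ,
    (∀ Z ∈ D.support, IsEquation Z V (φ Z)) ∧ f = D.prod fun Z n => φ Z ^ n

/-! ### Sheaves of modules and the line bundle of a divisor -/

/-- Presheaves of `𝒪`-modules on `E ^ g` whose sections are complex-valued functions:
a section over `U` is recorded as a function on all of `E ^ g`, extended by zero where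
it is not defined. The restriction of a section `s` to `V` is `Set.indicator V s`, and holomorphic
functions act by multiplication. -/
structure FunSheaf (L : PeriodPair) (g : ℕ) where
  /-- the sections over an open set -/
  sec : Opens (Pow L g) → AddSubgroup (Pow L g → ℂ)
  mul_mem : ∀ (U : Opens (Pow L g)) (f : Pow L g → ℂ), HolOn U f → ∀ s ∈ sec U, f * s ∈ sec U
  res_mem : ∀ (U V : Opens (Pow L g)), V ≤ U → ∀ s ∈ sec U,
    Set.indicator (V : Set (Pow L g)) s ∈ sec V

/-- The invertible sheaf `𝒪(D)` of an effective divisor `D`: its sections over `U` are the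
meromorphic functions `s` on `U` with `div s + D ≥ 0`, that is, the functions on `U` minus the
support of `D` such that `f * s` extends to a holomorphic function on `V`, for every local equation
`f` of `D` on an open `V ⊆ U`. -/
def lineBundle (D : EffDivisor L g) : FunSheaf L g where
  sec U :=
    { carrier := {s | (∀ p, p ∉ U ∨ p ∈ supp D → s p = 0) ∧
        ∀ V : Opens (Pow L g), V ≤ U → ∀ f, IsLocalEquation D V f →
          ∃ k, HolOn V k ∧ ∀ p ∈ V, p ∉ supp D → f p * s p = k p}
      zero_mem' := ⟨fun _ _ => rfl, fun V _ f _ =>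
        ⟨0, by unfold HolOn; exact differentiableOn_const (c := (0 : ℂ)), fun p _ _ => by simp⟩⟩
      add_mem' := by
        rintro s t ⟨hs, hs'⟩ ⟨ht, ht'⟩
        refine ⟨fun p hp => by simp [hs p hp, ht p hp], fun V hV f hf => ?_⟩
        obtain ⟨k, hk, hk'⟩ := hs' V hV f hf
        obtain ⟨l, hl, hl'⟩ := ht' V hV f hf
        exact ⟨k + l, DifferentiableOn.add hk hl, fun p hp hp' => by
          simp [mul_add, hk' p hp hp', hl' p hp hp']⟩
      neg_mem' := by
        rintro s ⟨hs, hs'⟩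
        refine ⟨fun p hp => by simp [hs p hp], fun V hV f hf => ?_⟩
        obtain ⟨k, hk, hk'⟩ := hs' V hV f hf
        exact ⟨-k, DifferentiableOn.neg hk, fun p hp hp' => by simp [← hk' p hp hp']⟩ }
  mul_mem := by
    rintro U h hh s ⟨hs, hs'⟩
    refine ⟨fun p hp => by simp [hs p hp], fun V hV f hf => ?_⟩
    obtain ⟨k, hk, hk'⟩ := hs' V hV f hf
    exact ⟨h * k, (hh.mono hV).mul hk, fun p hp hp' => by
      simp only [Pi.mul_apply, ← hk' p hp hp']; ring⟩
  res_mem := by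
    rintro U V hVU s ⟨hs, hs'⟩
    refine ⟨fun p hp => ?_, fun W hW f hf => ?_⟩
    · rcases hp with hp | hp
      · exact Set.indicator_of_notMem hp s
      · by_cases hpV : p ∈ (V : Set (Pow L g))
        · rw [Set.indicator_of_mem hpV]; exact hs p (Or.inr hp)
        · exact Set.indicator_of_notMem hpV s
    · obtain ⟨k, hk, hk'⟩ := hs' W (hW.trans hVU) f hf
      exact ⟨k, hk, fun p hp hp' => by
        rw [Set.indicator_of_mem (show p ∈ (V : Set (Pow L g)) from hW hp)]; exact hk' p hp hp'⟩

/-- The image `x + U` of the open set `U` under the translation `t_x : p ↦ p + x`. -/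
def translate (x : Pow L g) (U : Opens (Pow L g)) : Opens (Pow L g) :=
  ⟨(fun p => p - x) ⁻¹' U, U.isOpen.preimage (by fun_prop)⟩

theorem HolOn.translate (x : Pow L g) {U : Opens (Pow L g)} {f : Pow L g → ℂ} (hf : HolOn U f) :
    HolOn (translate x U) fun p => f (p - x) := by
  obtain ⟨c, rfl⟩ : ∃ c, proj L g c = x := by
    choose c hc using fun i => L.lattice.mkQ_surjective (x i)
    exact ⟨c, funext hc⟩
  have h : ∀ z, proj L g z - proj L g c = proj L g (z - c) := fun z => by
    funext i; simp [proj]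
  have h2 : DifferentiableOn ℂ (fun z : Fin g → ℂ => z - c)
      (proj L g ⁻¹' (EllPow.translate (proj L g c) U)) := by fun_prop
  have h3 := DifferentiableOn.comp hf h2 (fun z hz => by
    change proj L g (z - c) ∈ U
    rw [← h]; exact hz)
  have h4 : (fun p => f (p - proj L g c)) ∘ proj L g = (f ∘ proj L g) ∘ fun z => z - c := by
    funext z
    simp [h]
  unfold HolOn
  rw [h4]
  exact h3

/-- The pullback `t_x ^* F` along the translation `t_x : p ↦ p + x`: its sections over `U` are
the functions `s' ∘ t_x` with `s'` a section of `F` over `x + U`. -/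
def pullback (x : Pow L g) (F : FunSheaf L g) : FunSheaf L g where
  sec U :=
    { carrier := {s | (fun p => s (p - x)) ∈ F.sec (translate x U)}
      zero_mem' := (F.sec (translate x U)).zero_mem
      add_mem' := fun hs ht => (F.sec (translate x U)).add_mem hs ht
      neg_mem' := fun hs => (F.sec (translate x U)).neg_mem hs }
  mul_mem _ _ hf _ hs := F.mul_mem _ _ (hf.translate x) _ hs
  res_mem U V hV _ hs :=
    F.res_mem (translate x U) (translate x V) (fun _ hp => hV hp) _ hs

theorem mem_pullback (x : Pow L g) (F : FunSheaf L g) (U : Opens (Pow L g)) (s : Pow L g → ℂ) :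
    s ∈ (pullback x F).sec U ↔ (fun p => s (p - x)) ∈ F.sec (translate x U) := Iff.rfl

/-- `F` and `G` are isomorphic as sheaves of `𝒪`-modules: there are additive bijections
`F(U) ≃ G(U)`, for all open `U`, which are linear over the holomorphic functions on `U` and
compatible with restriction. -/
def Isomorphic (F G : FunSheaf L g) : Prop :=
  ∃ e : ∀ U, F.sec U ≃+ G.sec U,
    (∀ (U : Opens (Pow L g)) (f : Pow L g → ℂ) (hf : HolOn U f) (s : F.sec U),
      e U ⟨f * s, F.mul_mem U f hf s s.2⟩ = ⟨f * e U s, G.mul_mem U f hf _ (e U s).2⟩) ∧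
    (∀ (U V : Opens (Pow L g)) (hV : V ≤ U) (s : F.sec U),
      e V ⟨Set.indicator V s, F.res_mem U V hV s s.2⟩ =
        ⟨Set.indicator V (e U s), G.res_mem U V hV _ (e U s).2⟩)

theorem Isomorphic.refl (F : FunSheaf L g) : Isomorphic F F :=
  ⟨fun _ => AddEquiv.refl _, fun _ _ _ _ => rfl, fun _ _ _ _ => rfl⟩

theorem Isomorphic.symm {F G : FunSheaf L g} (h : Isomorphic F G) : Isomorphic G F := by
  obtain ⟨e, he, he'⟩ := h
  refine ⟨fun U => (e U).symm, fun U f hf s => ?_, fun U V hV s => ?_⟩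
  · rw [AddEquiv.symm_apply_eq, he U f hf]; simp
  · rw [AddEquiv.symm_apply_eq, he' U V hV]; simp

theorem Isomorphic.trans {F G H : FunSheaf L g} (h₁ : Isomorphic F G) (h₂ : Isomorphic G H) :
    Isomorphic F H := by
  obtain ⟨e, he, he'⟩ := h₁
  obtain ⟨d, hd, hd'⟩ := h₂
  refine ⟨fun U => (e U).trans (d U), fun U f hf s => ?_, fun U V hV s => ?_⟩
  · simp only [AddEquiv.trans_apply]; rw [he U f hf, hd U f hf]
  · simp only [AddEquiv.trans_apply]; rw [he' U V hV, hd' U V hV]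

theorem Isomorphic.pullback (x : Pow L g) {F G : FunSheaf L g} (h : Isomorphic F G) :
    Isomorphic (pullback x F) (pullback x G) := by
  obtain ⟨e, he, he'⟩ := h
  have key : ∀ H : FunSheaf L g, ∀ U, ∀ s : H.sec (translate x U),
      (fun p => s.1 (p + x)) ∈ (EllPow.pullback x H).sec U := fun H U s => by
    rw [mem_pullback]
    simp
  let τ : ∀ H : FunSheaf L g, ∀ U, (EllPow.pullback x H).sec U ≃+ H.sec (translate x U) :=
    fun H U =>
    { toFun := fun s => ⟨fun p => s.1 (p - x), s.2⟩
      invFun := fun s => ⟨fun p => s.1 (p + x), key H U s⟩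
      left_inv := fun s => by simp
      right_inv := fun s => by simp
      map_add' := fun _ _ => rfl }
  refine ⟨fun U => ((τ F U).trans (e _)).trans (τ G U).symm, fun U f hf s => ?_,
    fun U V hV s => ?_⟩
  · simp only [AddEquiv.trans_apply]
    rw [AddEquiv.symm_apply_eq]
    refine (he _ _ (hf.translate x) (τ F U s)).trans (Subtype.ext ?_)
    funext p
    simp [τ]
  · simp only [AddEquiv.trans_apply]
    rw [AddEquiv.symm_apply_eq]
    refine (he' (translate x U) (translate x V) (fun _ hp => hV hp) (τ F U s)).trans
      (Subtype.ext ?_)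
    funext p
    by_cases hp : p - x ∈ (V : Set (Pow L g))
    · have hp' : p ∈ (translate x V : Set (Pow L g)) := hp
      simp only [τ, Set.indicator_of_mem hp']
      simp [hp]
    · have hp' : p ∉ (translate x V : Set (Pow L g)) := hp
      simp only [τ, Set.indicator_of_notMem hp']
      simp [hp]

theorem FunSheaf.ext' {F G : FunSheaf L g} (h : ∀ U s, s ∈ F.sec U ↔ s ∈ G.sec U) : F = G := by
  cases F; cases G
  simp only [FunSheaf.mk.injEq]
  funext U
  exact AddSubgroup.ext (h U)

theorem pullback_zero (F : FunSheaf L g) : pullback 0 F = F := by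
  refine FunSheaf.ext' fun U s => ?_
  rw [mem_pullback]
  have : translate 0 U = U := by ext p; simp [translate]
  simp [this]

theorem pullback_add (x y : Pow L g) (F : FunSheaf L g) :
    pullback (x + y) F = pullback x (pullback y F) := by
  refine FunSheaf.ext' fun U s => ?_
  rw [mem_pullback, mem_pullback, mem_pullback]
  have h : ∀ p : Pow L g, p - (x + y) = p - y - x := fun p => by abel
  have : translate (x + y) U = translate y (translate x U) := by
    ext p; simp [translate, h]
  simp [this, h]

/-- The group `K(D)` of all `x` with `t_x ^* 𝒪(D) ≅ 𝒪(D)`. -/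
def K (D : EffDivisor L g) : AddSubgroup (Pow L g) where
  carrier := {x | Isomorphic (pullback x (lineBundle D)) (lineBundle D)}
  zero_mem' := by
    change Isomorphic _ _
    rw [pullback_zero]; exact Isomorphic.refl _
  add_mem' {x y} hx hy := by
    change Isomorphic _ _
    rw [pullback_add]; exact (Isomorphic.pullback x hy).trans hx
  neg_mem' {x} hx := by
    have h := (Isomorphic.pullback (-x) hx).symm
    rwa [← pullback_add, neg_add_cancel, pullback_zero] at h

/-- `D` has type `(d_1, …, d_g)`: the `d_i` are positive, `d_i ∣ d_j` for `i ≤ j`, and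
`K(D) ≅ Z ⊕ Z` with `Z = ⨁ ℤ / d_i`. -/
def HasType (D : EffDivisor L g) (d : Fin g → ℕ) : Prop :=
  (∀ i, 0 < d i) ∧ (∀ i j, i ≤ j → d i ∣ d j) ∧
    Nonempty (K D ≃+ (∀ i, ZMod (d i)) × (∀ i, ZMod (d i)))

/-! ### The divisor `Ξ_g` -/

/-- `Θ_g = ∑ π_i ^* [0]`. As the projection `π_i` is smooth, `π_i ^* [0]` is the reduced
hypersurface `π_i ⁻¹ {0}`. -/
def Theta (L : PeriodPair) (g : ℕ) : EffDivisor L g :=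
  ∑ i : Fin g, Finsupp.single {p : Pow L g | p i = 0} 1

/-- The sum morphism `Σ : E ^ g → E`. -/
def sumHom (L : PeriodPair) (g : ℕ) : Pow L g →+ Curve L where
  toFun p := ∑ i, p i
  map_zero' := by simp
  map_add' p q := by simp [Finset.sum_add_distrib]

/-- `Ξ_g = Θ_g + ker Σ`. -/
def Xi (L : PeriodPair) (g : ℕ) : EffDivisor L g :=
  Theta L g + Finsupp.single ((sumHom L g).ker : Set (Pow L g)) 1

/-- The abelian variety `X = {(x_1, …, x_{g+1}) ∈ E ^ (g+1) | ∑ x_i = 0}`. -/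
def sumZero (L : PeriodPair) (g : ℕ) : AddSubgroup (Pow L (g + 1)) := (sumHom L (g + 1)).ker

/-- The isomorphism `X ≅ E ^ g` that forgets the last coordinate. -/
def sumZeroEquiv (L : PeriodPair) (g : ℕ) : sumZero L g ≃+ Pow L g where
  toFun x := fun i => x.1 i.castSucc
  invFun y := ⟨Fin.snoc (α := fun _ => Curve L) y (-∑ i, y i), by
    rw [sumZero, AddMonoidHom.mem_ker]
    simp [sumHom, Fin.sum_univ_castSucc]⟩
  left_inv x := by
    have hx : ∑ i, x.1 i = 0 := x.2
    rw [Fin.sum_univ_castSucc] at hx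
    apply Subtype.ext
    funext i
    refine Fin.lastCases ?_ (fun j => ?_) i
    · simp only [Fin.snoc_last]
      exact neg_eq_of_add_eq_zero_right hx
    · simp only [Fin.snoc_castSucc]
  right_inv y := by funext i; simp
  map_add' _ _ := rfl

end EllPow

end

noncomputable section

namespace EllPow

open Set Filter Topology MeasureTheory Metric

variable {L : PeriodPair} {g : ℕ}

/-! Write Λ = ℤω + ℤω' and let θ be an entire function with simple zeros exactly on Λ such that θ(z
+ ω) = θ(z) and θ(z + ω') = -exp(-2πiz/ω) θ(z) (`nonempty_thetaFunction`). Then ξ(z) = θ(z_1)⋯θ(z_g)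
θ(∑ z_j) defines the pullback of Ξ_g to ℂ^g. It is periodic under ω e_i and picks up exp(-2πi(z_i +
∑ z_j)/ω) under ω' e_i.

The sections of 𝒪(Ξ_g) are the quotients T/ξ (`ThetaFunction.isPresentation_Xi`), and if x is the
class of c, those of t_x^*𝒪(Ξ_g) are the quotients T/ξ(· + c). This rests on a division lemma: a
holomorphic function vanishing where a linear form l takes values in Λ is divisible by θ ∘ l
(`ThetaFunction.exists_eq_mul`). An isomorphism of the two sheaves amounts to a nowhere vanishing
entire E for which E(z) ξ(z + c)/ξ(z) is periodic (`IsPresentation.isomorphic`,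
`IsPresentation.exists_of_isomorphic`).

Such an E is periodic under ω e_i and has multiplier exp(2πi(c_i + ∑ c_j)/ω) under ω' e_i. On the
i-th axis its logarithmic derivative is elliptic without poles, hence constant. So E is an
exponential there, its multiplier is exp(2πi m ω'/ω) for an integer m, and c_i + ∑ c_j ∈ Λ. Thus x_i
= -∑ x_j for all i, so that x = (t, …, t) with (g + 1)t = 0. Conversely, for such x an exponential
in ∑ z_j serves as E. Hence K(Ξ_g) ≅ E[g+1] ≅ (ℤ/(g+1))², which gives the type. In X, the omitted
coordinate is -gt = t. -/

/-! ### Holomorphic functions of several variables -/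

/-- An integral over a compact interval depends holomorphically on parameters if the integrand is
bounded, holomorphic in the parameters and continuous in the variable of integration. -/
theorem differentiableOn_intervalIntegral {n : ℕ} {F : (Fin n → ℂ) → ℝ → ℂ} {O : Set (Fin n → ℂ)}
    (hO : IsOpen O) {M : ℝ} (a b : ℝ) (hd : ∀ t, DifferentiableOn ℂ (fun z => F z t) O)
    (hM : ∀ z ∈ O, ∀ t, ‖F z t‖ ≤ M) (hc : ∀ z ∈ O, Continuous (F z)) :
    DifferentiableOn ℂ (fun z => ∫ t in a..b, F z t) O := by
  -- An interval integral is a difference of two integrals against finite measures, so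
  -- differentiation under the integral sign is only needed for those.
  have key : ∀ (μ : Measure ℝ) [IsFiniteMeasure μ],
      DifferentiableOn ℂ (fun z => ∫ t, F z t ∂μ) O := by
    intro μ _ z₀ hz₀
    obtain ⟨δ, hδ, hδO⟩ := Metric.isOpen_iff.1 hO z₀ hz₀
    have hder : ∀ t, ∀ z ∈ O, HasFDerivAt (fun z => F z t) (fderiv ℂ (fun z => F z t) z) z :=
      fun t z hz => ((hd t).differentiableAt (hO.mem_nhds hz)).hasFDerivAt
    -- Each directional derivative is a pointwise limit of difference quotients, which are
    -- continuous in `t`. Finitely many coordinate directions determine the whole derivative.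
    have hmeas : AEStronglyMeasurable (fun t => fderiv ℂ (fun z => F z t) z₀) μ := by
      have h1 : ∀ v : Fin n → ℂ, Measurable fun t => fderiv ℂ (fun z => F z t) z₀ v := by
        intro v
        have hlim : Tendsto (fun m : ℕ => z₀ + ((m : ℂ) + 1)⁻¹ • v) atTop (𝓝 z₀) := by
          have h0 : Tendsto (fun m : ℕ => ((m : ℂ) + 1)⁻¹) atTop (𝓝 0) := by
            simpa [one_div] using tendsto_one_div_add_atTop_nhds_zero_nat (𝕜 := ℂ)
          simpa using tendsto_const_nhds.add (h0.smul_const v)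
        obtain ⟨N, hN⟩ := eventually_atTop.1 (hlim.eventually (hO.mem_nhds hz₀))
        refine measurable_of_tendsto_metrizable (f := fun (m : ℕ) t =>
          ((m + N : ℕ) + 1 : ℂ) • (F (z₀ + (((m + N : ℕ) : ℂ) + 1)⁻¹ • v) t - F z₀ t)) ?_ ?_
        · intro m
          have := hc _ (hN (m + N) (by omega))
          have := hc _ hz₀
          exact Continuous.measurable (by fun_prop)
        · refine tendsto_pi_nhds.2 fun t => ?_
          have h2 : Tendsto (fun m : ℕ => ‖((m : ℂ) + 1)‖) atTop atTop := by
            have h3 : Tendsto (fun m : ℕ => ((m : ℝ) + 1)) atTop atTop :=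
              tendsto_atTop_add_const_right _ _ tendsto_natCast_atTop_atTop
            refine h3.congr fun m => ?_
            rw [show ((m : ℂ) + 1) = ((m + 1 : ℕ) : ℂ) by push_cast; ring, Complex.norm_natCast]
            push_cast; ring
          exact ((hder t z₀ hz₀).lim v h2).comp (tendsto_add_atTop_nat N)
      have h2 : (fun t => fderiv ℂ (fun z => F z t) z₀) = fun t =>
          ∑ i, (fderiv ℂ (fun z => F z t) z₀ (Pi.single i 1)) •
            (ContinuousLinearMap.proj i : (Fin n → ℂ) →L[ℂ] ℂ) := by
        funext t
        refine ContinuousLinearMap.ext fun v => ?_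
        conv_lhs => rw [pi_eq_sum_univ' v]
        simp [mul_comm]
      rw [h2]
      refine Finset.aestronglyMeasurable_fun_sum _ fun i _ => ?_
      exact (h1 _).aestronglyMeasurable.smul_const _
    -- The dominating constant is the Cauchy estimate on a ball of radius `δ / 2` that stays inside
    -- `O`, where values of `F` differ by at most `2 * M`.
    refine (hasFDerivAt_integral_of_dominated_of_fderiv_le (μ := μ)
      (F' := fun z t => fderiv ℂ (fun z => F z t) z) (bound := fun _ => (2 * M) / (δ / 2))
      (s := ball z₀ (δ / 2)) (ball_mem_nhds _ (by positivity)) ?_ ?_ hmeas ?_ ?_ ?_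
      ).differentiableAt.differentiableWithinAt
    · filter_upwards [hO.mem_nhds hz₀] with z hz
      exact (hc z hz).aestronglyMeasurable
    · exact Integrable.of_bound (hc z₀ hz₀).aestronglyMeasurable M
        (Eventually.of_forall (hM z₀ hz₀))
    · refine Eventually.of_forall fun t z hz => ?_
      have hsub : ball z (δ / 2) ⊆ O := by
        refine Subset.trans (fun y hy => ?_) hδO
        rw [mem_ball] at hy hz ⊢
        linarith [dist_triangle y z z₀]
      refine Complex.norm_fderiv_le_div_of_mapsTo_ball ((hd t).mono hsub) (fun y hy => ?_)
        (by positivity)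
      rw [mem_closedBall, dist_eq_norm]
      have := hM y (hsub hy) t
      have := hM z (hsub (mem_ball_self (by positivity))) t
      linarith [norm_sub_le (F y t) (F z t)]
    · exact integrable_const _
    · refine Eventually.of_forall fun t z hz => hder t z (hδO ?_)
      rw [mem_ball] at hz ⊢
      linarith
  simp only [intervalIntegral]
  exact (key _).sub (key _)

/-- A holomorphic function that vanishes on the zero set of a linear form is a multiple of it. -/
theorem exists_eq_linear_mul {n : ℕ} {h : (Fin n → ℂ) → ℂ} {l : (Fin n → ℂ) →L[ℂ] ℂ}
    {e z₀ : Fin n → ℂ} (he : l e = 1) (hz₀ : l z₀ = 0)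
    (hd : ∀ᶠ z in 𝓝 z₀, DifferentiableAt ℂ h z) (hv : ∀ᶠ z in 𝓝 z₀, l z = 0 → h z = 0) :
    ∃ k : (Fin n → ℂ) → ℂ, (∀ᶠ z in 𝓝 z₀, DifferentiableAt ℂ k z) ∧
      ∀ᶠ z in 𝓝 z₀, h z = l z * k z := by
  have hb : ∀ᶠ z in 𝓝 z₀, ‖h z‖ < ‖h z₀‖ + 1 :=
    hd.self_of_nhds.continuousAt.norm.eventually_lt_const (by linarith)
  obtain ⟨R, hR, hball⟩ := Metric.eventually_nhds_iff_ball.1 (hd.and (hv.and hb))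
  set M := ‖h z₀‖ + 1
  -- `P` projects onto the kernel of `l` along `e`. On each line ζ ↦ P z + ζ e the function `h`
  -- vanishes at ζ = 0, so division by ζ is possible there. Cauchy's formula on a fixed circle,
  -- evaluated at ζ = l z, makes the quotient holomorphic in `z` jointly.
  set P : (Fin n → ℂ) → (Fin n → ℂ) := fun z => z - l z • e with hP
  have hPc : Continuous P := by fun_prop
  have hlP : ∀ z, l (P z) = 0 := fun z => by simp [hP, he]
  -- This radius gives `r * ‖e‖ ≤ R / 2`, so the closed disc of radius `r` on each line stays in the
  -- ball of radius `R`. On `O`, the bound `‖l z‖ < r / 2` keeps the Cauchy kernel away from its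
  -- pole.
  set r : ℝ := R / (2 * (‖e‖ + 1)) with hr
  have he0 : 0 ≤ ‖e‖ := norm_nonneg e
  have hr0 : 0 < r := by positivity
  have hre : r * ‖e‖ ≤ R / 2 := by
    rw [hr, div_mul_eq_mul_div, div_le_div_iff₀ (by positivity) (by positivity)]
    nlinarith
  set O : Set (Fin n → ℂ) := {z | ‖l z‖ < r / 2} ∩ {z | ‖P z - z₀‖ < R / 2} with hOdef
  have hO : IsOpen O := (isOpen_lt (by fun_prop) continuous_const).inter
    (isOpen_lt (by fun_prop) continuous_const)
  have hz₀O : z₀ ∈ O := by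
    constructor
    · simp [hz₀, hr0]
    · simp [hP, hz₀, hR]
  have hin : ∀ z ∈ O, ∀ ζ : ℂ, ‖ζ‖ ≤ r → P z + ζ • e ∈ ball z₀ R := by
    intro z hz ζ hζ
    rw [mem_ball, dist_eq_norm, show P z + ζ • e - z₀ = (P z - z₀) + ζ • e by abel]
    have h1 : ‖P z - z₀‖ < R / 2 := hz.2
    have h2 : ‖ζ • e‖ ≤ r * ‖e‖ := by rw [norm_smul]; gcongr
    linarith [norm_add_le (P z - z₀) (ζ • e)]
  have hcirc : ∀ t, ‖circleMap 0 r t‖ = r := fun t => by simp [abs_of_pos hr0]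
  have hne : ∀ t, circleMap 0 r t ≠ 0 := fun t ht => by
    have := hcirc t; rw [ht, norm_zero] at this; linarith
  have hge : ∀ z ∈ O, ∀ t, r / 2 ≤ ‖circleMap 0 r t - l z‖ := fun z hz t => by
    have h1 : ‖l z‖ < r / 2 := hz.1
    have := norm_sub_norm_le (circleMap 0 r t) (l z)
    rw [hcirc] at this
    linarith
  have hne' : ∀ z ∈ O, ∀ t, circleMap 0 r t - l z ≠ 0 := fun z hz t ht => by
    have := hge z hz t; rw [ht, norm_zero] at this; linarith
  set F : (Fin n → ℂ) → ℝ → ℂ := fun z t => deriv (circleMap 0 r) t *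
    ((circleMap 0 r t - l z)⁻¹ * ((circleMap 0 r t)⁻¹ * h (P z + circleMap 0 r t • e))) with hF
  have hkd : DifferentiableOn ℂ (fun z => ∫ t in (0 : ℝ)..2 * Real.pi, F z t) O := by
    refine differentiableOn_intervalIntegral hO (M := r * ((r / 2)⁻¹ * (r⁻¹ * M))) _ _ ?_ ?_ ?_
    · intro t z hz
      have h1 : DifferentiableAt ℂ h (P z + circleMap 0 r t • e) :=
        (hball _ (hin z hz _ (hcirc t).le)).1
      have h2 : DifferentiableAt ℂ (fun z => P z + circleMap 0 r t • e) z := by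
        simp only [hP]; fun_prop
      have h3 : DifferentiableAt ℂ (fun z => h (P z + circleMap 0 r t • e)) z :=
        DifferentiableAt.comp z h1 h2
      have h4 : DifferentiableAt ℂ (fun z => (circleMap 0 r t - l z)⁻¹) z :=
        DifferentiableAt.inv (by fun_prop) (hne' z hz t)
      exact ((h4.mul (h3.const_mul _)).const_mul _).differentiableWithinAt
    · intro z hz t
      have h1 := (hball _ (hin z hz _ (hcirc t).le)).2.2
      have h2 := hge z hz t
      simp only [hF, norm_mul, norm_inv, hcirc]
      have h3 : ‖deriv (circleMap 0 r) t‖ = r := by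
        rw [deriv_circleMap]; simp [abs_of_pos hr0]
      rw [h3]
      gcongr
    · intro z hz
      have hcm : Continuous (circleMap 0 r) := continuous_circleMap 0 r
      have h0 : Continuous (deriv (circleMap 0 r)) := by
        have : deriv (circleMap 0 r) = fun t => circleMap 0 r t * Complex.I := by
          funext t; simp [deriv_circleMap]
        rw [this]; fun_prop
      have h1 : Continuous fun t => h (P z + circleMap 0 r t • e) := by
        rw [continuous_iff_continuousAt]
        intro t
        have h2 : ContinuousAt h (P z + circleMap 0 r t • e) :=
          (hball _ (hin z hz _ (hcirc t).le)).1.continuousAt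
        exact ContinuousAt.comp (f := fun t => P z + circleMap 0 r t • e) h2 (by fun_prop)
      exact h0.mul (((hcm.sub continuous_const).inv₀ (hne' z hz)).mul
        ((hcm.inv₀ hne).mul h1))
  refine ⟨fun z => (2 * Real.pi * Complex.I : ℂ)⁻¹ * ∫ t in (0 : ℝ)..2 * Real.pi, F z t, ?_, ?_⟩
  · filter_upwards [hO.mem_nhds hz₀O] with z hz
    exact (hkd.differentiableAt (hO.mem_nhds hz)).const_mul _
  · filter_upwards [hO.mem_nhds hz₀O] with z hz
    set φ : ℂ → ℂ := fun w => h (P z + w • e) with hφ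
    have hφ0 : φ 0 = 0 := by
      have h1 := (hball _ (hin z hz 0 (by simpa using hr0.le))).2.1
      refine h1 ?_
      simp [hlP]
    have hopen : IsOpen {w : ℂ | P z + w • e ∈ ball z₀ R} := isOpen_ball.preimage (by fun_prop)
    have hsub : closedBall (0 : ℂ) r ⊆ {w : ℂ | P z + w • e ∈ ball z₀ R} := fun w hw => by
      have hw' : ‖w‖ ≤ r := by simpa using hw
      exact hin z hz w hw'
    have hφd : DifferentiableOn ℂ φ {w : ℂ | P z + w • e ∈ ball z₀ R} := fun w hw => by
      have h1 : DifferentiableAt ℂ h (P z + w • e) := (hball _ hw).1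
      exact (DifferentiableAt.comp (f := fun w : ℂ => P z + w • e) w h1
        (by fun_prop)).differentiableWithinAt
    have hds : DifferentiableOn ℂ (dslope φ 0) {w : ℂ | P z + w • e ∈ ball z₀ R} :=
      (Complex.differentiableOn_dslope (hopen.mem_nhds
        (hsub (by simp [hr0.le])))).2 hφd
    have hcl : DiffContOnCl ℂ (dslope φ 0) (ball 0 r) :=
      DifferentiableOn.diffContOnCl (hds.mono (closure_ball_subset_closedBall.trans hsub))
    have hlz : l z ∈ ball (0 : ℂ) r := by
      have : ‖l z‖ < r / 2 := hz.1
      rw [mem_ball_zero_iff]; linarith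
    have hint := hcl.two_pi_i_inv_smul_circleIntegral_sub_inv_smul hlz
    have hhz : h z = l z * dslope φ 0 (l z) := by
      have h1 := sub_smul_dslope φ 0 (l z)
      rw [sub_zero, hφ0, sub_zero, smul_eq_mul] at h1
      rw [h1, hφ]
      congr 1
      simp [hP]
    rw [hhz, ← hint, circleIntegral]
    congr 2
    refine intervalIntegral.integral_congr fun t _ => ?_
    simp only [hF, smul_eq_mul]
    rw [dslope_of_ne _ (hne t), slope_def_field, hφ0, sub_zero, sub_zero]
    simp only [hφ]
    ring

theorem differentiableOn_finsetProd {E ι : Type*} [NormedAddCommGroup E] [NormedSpace ℂ E]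
    (s : Finset ι) {f : ι → E → ℂ} {W : Set E} (hf : ∀ i, DifferentiableOn ℂ (f i) W) :
    DifferentiableOn ℂ (fun z => ∏ i ∈ s, f i z) W := by
  classical
  induction s using Finset.induction_on with
  | empty => simp
  | insert a s ha ih =>
    simp only [Finset.prod_insert ha]
    exact (hf a).mul ih

/-- A function on a dense subset which is locally the restriction of functions continuous on
an open set is extended by `extendFrom`. -/
theorem extendFrom_eqOn {X : Type*} [TopologicalSpace X] {S W : Set X} (hS : Dense S)
    (hW : IsOpen W) {F k : X → ℂ} (hk : ContinuousOn k W) (hFk : ∀ x ∈ W, x ∈ S → F x = k x) :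
    ∀ x ∈ W, extendFrom S F x = k x := by
  intro x hx
  refine extendFrom_eq (hS x) ?_
  have h1 : Tendsto k (𝓝[S] x) (𝓝 (k x)) :=
    (hk.continuousAt (hW.mem_nhds hx)).mono_left nhdsWithin_le_nhds
  refine h1.congr' ?_
  filter_upwards [self_mem_nhdsWithin, mem_nhdsWithin_of_mem_nhds (hW.mem_nhds hx)] with y hy hy'
  exact (hFk y hy' hy).symm

/-- Functions continuous on an open set are determined by their values on a dense set. -/
theorem eqOn_of_dense {X : Type*} [TopologicalSpace X] {S W : Set X} (hS : Dense S)
    (hW : IsOpen W) {f k : X → ℂ} (hf : ContinuousOn f W) (hk : ContinuousOn k W)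
    (h : ∀ x ∈ W, x ∈ S → f x = k x) : ∀ x ∈ W, f x = k x := fun x hx =>
  (extendFrom_eqOn hS hW (F := f) hf (fun _ _ _ => rfl) x hx).symm.trans
    (extendFrom_eqOn hS hW hk h x hx)

/-- A function on a dense subset which is locally the restriction of holomorphic functions is
extended holomorphically by `extendFrom`. -/
theorem differentiableOn_extendFrom {E : Type*} [NormedAddCommGroup E] [NormedSpace ℂ E]
    {S W : Set E} (hS : Dense S) {F : E → ℂ}
    (hloc : ∀ z₀ ∈ W, ∃ k : E → ℂ, (∀ᶠ z in 𝓝 z₀, DifferentiableAt ℂ k z) ∧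
      ∀ᶠ z in 𝓝 z₀, z ∈ S → F z = k z) :
    DifferentiableOn ℂ (extendFrom S F) W ∧ ∀ z ∈ W, z ∈ S → extendFrom S F z = F z := by
  have key : ∀ z₀ ∈ W, ∃ k : E → ℂ, DifferentiableAt ℂ k z₀ ∧ (z₀ ∈ S → F z₀ = k z₀) ∧
      extendFrom S F =ᶠ[𝓝 z₀] k := by
    intro z₀ hz₀
    obtain ⟨k, hk, hk'⟩ := hloc z₀ hz₀
    obtain ⟨V, hV, hVo, hzV⟩ := _root_.eventually_nhds_iff.1 (hk.and hk')
    refine ⟨k, hk.self_of_nhds, hk'.self_of_nhds, ?_⟩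
    filter_upwards [hVo.mem_nhds hzV] with z hz
    exact extendFrom_eqOn hS hVo (fun y hy => (hV y hy).1.continuousAt.continuousWithinAt)
      (fun y hy => (hV y hy).2) z hz
  refine ⟨fun z₀ hz₀ => ?_, fun z₀ hz₀ hz₀S => ?_⟩
  · obtain ⟨k, hk, -, heq⟩ := key z₀ hz₀
    exact (heq.differentiableAt_iff.2 hk).differentiableWithinAt
  · obtain ⟨k, -, hk, heq⟩ := key z₀ hz₀
    rw [hk hz₀S, heq.self_of_nhds]

/-! ### The theta function of a lattice -/

/-- The product `∏_{n ≥ 1} (1 - q ^ n w)`. -/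
def qProd (q w : ℂ) : ℂ := ∏' n : ℕ, (1 + -(q ^ (n + 1) * w))

theorem summable_qProd {q : ℂ} (hq : ‖q‖ < 1) (w : ℂ) :
    Summable fun n : ℕ => ‖-(q ^ (n + 1) * w)‖ := by
  simp only [norm_neg, norm_mul, norm_pow]
  exact ((summable_nat_add_iff 1).2 (summable_geometric_of_lt_one (norm_nonneg _) hq)).mul_right _

/-- On every ball the terms are dominated by a geometric series, so the product converges locally
uniformly. -/
theorem differentiable_qProd {q : ℂ} (hq : ‖q‖ < 1) : Differentiable ℂ (qProd q) := by
  intro w₀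
  have hs : Summable fun n : ℕ => ‖q‖ ^ (n + 1) * (‖w₀‖ + 1) :=
    ((summable_nat_add_iff 1).2 (summable_geometric_of_lt_one (norm_nonneg _) hq)).mul_right _
  have h1 := hs.hasProdLocallyUniformlyOn_nat_one_add (f := fun (n : ℕ) w => -(q ^ (n + 1) * w))
    (K := ball (0 : ℂ) (‖w₀‖ + 1)) isOpen_ball
    (Eventually.of_forall fun n w hw => by
      have hw' : ‖w‖ < ‖w₀‖ + 1 := by simpa using hw
      simp only [norm_neg, norm_mul, norm_pow]
      gcongr) (fun n => by fun_prop)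
  have h2 : DifferentiableOn ℂ (qProd q) (ball (0 : ℂ) (‖w₀‖ + 1)) :=
    h1.differentiableOn (Eventually.of_forall fun s => by
      simpa [Finset.prod_fn] using DifferentiableOn.finsetProd (fun _ _ => by fun_prop)) isOpen_ball
  exact h2.differentiableAt (isOpen_ball.mem_nhds (by simp))

/-- Splitting off the first factor shifts the index of the others by one. This is the source of the
quasi-periodicity of θ. -/
theorem qProd_eq {q : ℂ} (hq : ‖q‖ < 1) (w : ℂ) : qProd q w = (1 - q * w) * qProd q (q * w) := by
  have h := multipliable_one_add_of_summable (summable_qProd hq w)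
  have h' := multipliable_one_add_of_summable (summable_qProd hq (q * w))
  rw [qProd, tprod_eq_zero_mul' ?_]
  · congr 1
    · ring
    · rw [qProd]
      exact tprod_congr fun n => by ring
  · exact h'.congr fun n => by ring

theorem qProd_ne_zero {q : ℂ} (hq : ‖q‖ < 1) {w : ℂ} (h : ∀ n : ℕ, q ^ (n + 1) * w ≠ 1) :
    qProd q w ≠ 0 :=
  tprod_one_add_ne_zero_of_summable (fun n hn => h n (by linear_combination -hn))
    (summable_qProd hq w)

/-- An entire function with simple zeros exactly at the lattice points, which is periodic for one
member of a basis of the lattice and quasi-periodic for the other one. -/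
structure ThetaFunction (L : PeriodPair) where
  /-- the function -/
  toFun : ℂ → ℂ
  /-- the period -/
  ω : ℂ
  /-- the quasi-period -/
  ω' : ℂ
  ω_ne_zero : ω ≠ 0
  mem_lattice_iff : ∀ z, z ∈ L.lattice ↔ ∃ m n : ℤ, z = m * ω + n * ω'
  differentiable : Differentiable ℂ toFun
  add_ω : ∀ z, toFun (z + ω) = toFun z
  add_ω' : ∀ z, toFun (z + ω') = -Complex.exp (-(2 * Real.pi * Complex.I * z / ω)) * toFun z
  eq_zero_iff : ∀ z, toFun z = 0 ↔ z ∈ L.lattice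
  deriv_zero : deriv toFun 0 ≠ 0

/-- Independence over ℝ means that ω₂/ω₁ is not real, and a change of sign of ω₂ preserves the
lattice. The orientation is what makes |q| < 1 for the product expansion of θ. -/
theorem exists_basis_im_pos (L : PeriodPair) : ∃ ω ω' : ℂ, ω ≠ 0 ∧ 0 < (ω' / ω).im ∧
    ∀ z, z ∈ L.lattice ↔ ∃ m n : ℤ, z = m * ω + n * ω' := by
  have h0 : L.ω₁ ≠ 0 := L.indep.ne_zero 0
  have him : (L.ω₂ / L.ω₁).im ≠ 0 := by
    intro him
    have h1 := LinearIndependent.pair_iff.1 L.indep (L.ω₂ / L.ω₁).re (-1) (by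
      have h2 : (((L.ω₂ / L.ω₁).re : ℝ) : ℂ) = L.ω₂ / L.ω₁ := Complex.ext (by simp) (by simp [him])
      rw [Complex.real_smul, h2]
      simp
      field_simp
      ring)
    simpa using h1.2
  rcases lt_or_gt_of_ne him with h | h
  · refine ⟨L.ω₁, -L.ω₂, h0, by simpa [neg_div] using h, fun z => ?_⟩
    rw [PeriodPair.mem_lattice]
    constructor
    · rintro ⟨m, n, rfl⟩; exact ⟨m, -n, by simp⟩
    · rintro ⟨m, n, rfl⟩; exact ⟨m, -n, by simp⟩
  · refine ⟨L.ω₁, L.ω₂, h0, h, fun z => ?_⟩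
    rw [PeriodPair.mem_lattice]
    constructor
    · rintro ⟨m, n, rfl⟩; exact ⟨m, n, rfl⟩
    · rintro ⟨m, n, rfl⟩; exact ⟨m, n, rfl⟩

/-- With u = exp(2πiz/ω) and q = exp(2πiω'/ω), the function is Jacobi's product (1 - u) ∏ (1 -
qⁿu)(1 - qⁿu⁻¹) over n ≥ 1. Its zeros are the points with u an integral power of q, that is, the
lattice points. -/
theorem nonempty_thetaFunction (L : PeriodPair) : Nonempty (ThetaFunction L) := by
  obtain ⟨ω, ω', hω, him, hL⟩ := exists_basis_im_pos L
  set q : ℂ := Complex.exp (2 * Real.pi * Complex.I * (ω' / ω)) with hqdef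
  have hq : ‖q‖ < 1 := by
    rw [hqdef, Complex.norm_exp, Real.exp_lt_one_iff]
    simp
    positivity
  have hq0 : q ≠ 0 := Complex.exp_ne_zero _
  set e : ℂ → ℂ := fun z => Complex.exp (2 * Real.pi * Complex.I * z / ω) with he
  have he0 : ∀ z, e z ≠ 0 := fun z => Complex.exp_ne_zero _
  have heq : ∀ z, e (z + ω') = q * e z := fun z => by
    simp only [he, hqdef, ← Complex.exp_add]; congr 1; field_simp; ring
  have hem : ∀ (m n : ℤ), e (m * ω + n * ω') = q ^ n := fun m n => by
    have : e (m * ω + n * ω') = Complex.exp (m * (2 * Real.pi * Complex.I)) * q ^ n := by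
      simp only [he, hqdef, ← Complex.exp_int_mul, ← Complex.exp_add]; congr 1; field_simp
    rw [this, Complex.exp_int_mul_two_pi_mul_I, one_mul]
  have hmem : ∀ (z : ℂ) (n : ℤ), e z = q ^ n → z ∈ L.lattice := fun z n hz => by
    rw [← hem 0 n] at hz
    simp only [he] at hz
    obtain ⟨m, hm⟩ := Complex.exp_eq_exp_iff_exists_int.1 hz
    refine (hL z).2 ⟨m, n, ?_⟩
    have hpi : (2 * Real.pi * Complex.I : ℂ) ≠ 0 := Complex.two_pi_I_ne_zero
    have h2 : 2 * Real.pi * Complex.I * z = 2 * Real.pi * Complex.I * (m * ω + n * ω') := by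
      field_simp at hm
      push_cast at hm
      linear_combination (2 * Real.pi * Complex.I) * hm
    exact mul_left_cancel₀ hpi h2
  have hed : Differentiable ℂ e := by simp only [he]; fun_prop
  have hPd := differentiable_qProd hq
  have hRd : Differentiable ℂ fun z => qProd q (e z) * qProd q (e z)⁻¹ :=
    (hPd.comp hed).mul (hPd.comp (hed.inv he0))
  refine ⟨⟨fun z => (1 - e z) * (qProd q (e z) * qProd q (e z)⁻¹), ω, ω', hω, hL,
    ((differentiable_const _).sub hed).mul hRd, fun z => ?_, fun z => ?_, fun z => ?_, ?_⟩⟩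
  · have : e (z + ω) = e z := by
      simp only [he]
      rw [mul_add, add_div, mul_div_cancel_right₀ _ hω, Complex.exp_add, Complex.exp_two_pi_mul_I,
        mul_one]
    simp only [this]
  · have h1 : Complex.exp (-(2 * Real.pi * Complex.I * z / ω)) = (e z)⁻¹ := by
      rw [Complex.exp_neg]
    -- The shift by ω' replaces u by qu: one product loses the factor 1 - qu, which the leading
    -- factor 1 - u has become, and the other gains 1 - u⁻¹. Since 1 - u⁻¹ = -u⁻¹(1 - u), the net
    -- factor is -u⁻¹.
    have h2 := qProd_eq hq (e z)
    have h3 := qProd_eq hq (q * e z)⁻¹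
    have h4 : q * (q * e z)⁻¹ = (e z)⁻¹ := by field_simp [he0 z]
    rw [h4] at h3
    simp only [h1, heq]
    rw [h2, h3]
    have := he0 z
    field_simp
    ring
  · constructor
    · intro hz
      by_contra hzL
      rcases mul_eq_zero.1 hz with h | h
      · exact hzL (hmem z 0 (by rw [zpow_zero]; linear_combination -h))
      · rcases mul_eq_zero.1 h with h | h
        · refine qProd_ne_zero hq (fun n hn => hzL (hmem z (-((n + 1 : ℕ) : ℤ)) ?_)) h
          rw [zpow_neg, zpow_natCast]
          exact eq_inv_of_mul_eq_one_right hn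
        · refine qProd_ne_zero hq (fun n hn => hzL (hmem z ((n + 1 : ℕ) : ℤ) ?_)) h
          rw [zpow_natCast]
          have := he0 z
          field_simp at hn
          exact hn.symm
    · intro hz
      obtain ⟨m, n, rfl⟩ := (hL z).1 hz
      simp only [hem]
      -- At u = qⁿ the vanishing factor lies in the product in u for n < 0, in the product in u⁻¹
      -- for n > 0, and is 1 - u for n = 0.
      have hz0 : ∀ k : ℕ, qProd q (q ^ (-((k + 1 : ℕ) : ℤ))) = 0 := by
        intro k
        induction k with
        | zero =>
          have : q * q ^ (-((0 + 1 : ℕ) : ℤ)) = 1 := by simp [hq0]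
          rw [qProd_eq hq, this, sub_self, zero_mul]
        | succ k ih =>
          rw [qProd_eq hq]
          have : q * q ^ (-((k + 1 + 1 : ℕ) : ℤ)) = q ^ (-((k + 1 : ℕ) : ℤ)) := by
            rw [← zpow_one_add₀ hq0]; congr 1
          rw [this, ih, mul_zero]
      rcases lt_trichotomy n 0 with hn | rfl | hn
      · obtain ⟨k, hk⟩ := Int.exists_eq_neg_ofNat hn.le
        obtain ⟨j, rfl⟩ : ∃ j, k = j + 1 := ⟨k - 1, by omega⟩
        rw [hk, hz0]; simp
      · simp
      · obtain ⟨k, hk⟩ := Int.eq_ofNat_of_zero_le hn.le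
        obtain ⟨j, rfl⟩ : ∃ j, k = j + 1 := ⟨k - 1, by omega⟩
        rw [hk, ← zpow_neg, hz0]; simp
  · have hR0 : qProd q 1 ≠ 0 := qProd_ne_zero hq fun n hn => by
      rw [mul_one] at hn
      have h1 : ‖q‖ ^ (n + 1) < 1 := pow_lt_one₀ (norm_nonneg _) hq (by omega)
      rw [← norm_pow, hn, norm_one] at h1
      exact lt_irrefl _ h1
    have he1 : e 0 = 1 := by simp [he]
    have hder : HasDerivAt e (2 * Real.pi * Complex.I / ω) 0 := by
      have h1 : HasDerivAt (fun z : ℂ => 2 * Real.pi * Complex.I * z / ω)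
          (2 * Real.pi * Complex.I / ω) 0 := by
        simpa using ((hasDerivAt_id (0 : ℂ)).const_mul (2 * Real.pi * Complex.I : ℂ)).div_const ω
      simpa using h1.cexp
    have h2 := (hder.const_sub 1).mul (hRd 0).hasDerivAt
    have h3 := h2.deriv
    simp only [he1, inv_one, sub_self, zero_mul, add_zero] at h3
    refine fun h4 => ?_
    have h5 := h3.symm.trans h4
    have hpi : (2 * Real.pi * Complex.I : ℂ) ≠ 0 := Complex.two_pi_I_ne_zero
    simp [hR0, hω] at h5

namespace ThetaFunction

variable {L : PeriodPair} (θ : ThetaFunction L)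

/-- Under a lattice translation, a theta function is multiplied by the exponential of an affine
function. -/
theorem exists_add_eq {l : ℂ} (hl : l ∈ L.lattice) :
    ∃ a b : ℂ, ∀ z, θ.toFun (z + l) = Complex.exp (a * z + b) * θ.toFun z := by
  have hneg : ∀ l, (∃ a b : ℂ, ∀ z, θ.toFun (z + l) = Complex.exp (a * z + b) * θ.toFun z) →
      ∃ a b : ℂ, ∀ z, θ.toFun (z + -l) = Complex.exp (a * z + b) * θ.toFun z := by
    rintro l ⟨a, b, h⟩
    refine ⟨-a, a * l - b, fun z => ?_⟩
    have := h (z + -l)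
    rw [neg_add_cancel_right] at this
    rw [this, ← mul_assoc, ← Complex.exp_add]
    ring_nf
    simp
  have hadd : ∀ l l', (∃ a b : ℂ, ∀ z, θ.toFun (z + l) = Complex.exp (a * z + b) * θ.toFun z) →
      (∃ a b : ℂ, ∀ z, θ.toFun (z + l') = Complex.exp (a * z + b) * θ.toFun z) →
      ∃ a b : ℂ, ∀ z, θ.toFun (z + (l + l')) = Complex.exp (a * z + b) * θ.toFun z := by
    rintro l l' ⟨a, b, h⟩ ⟨a', b', h'⟩
    refine ⟨a + a', a' * l + b + b', fun z => ?_⟩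
    rw [← add_assoc, h', h, ← mul_assoc, ← Complex.exp_add]
    ring_nf
  -- The periods with an exponential factor of this kind form a subgroup, so it suffices to treat ω
  -- and ω'. For ω' the sign is absorbed as exp(πi).
  let S : AddSubgroup ℂ :=
    { carrier := {l | ∃ a b : ℂ, ∀ z, θ.toFun (z + l) = Complex.exp (a * z + b) * θ.toFun z}
      zero_mem' := ⟨0, 0, fun z => by simp⟩
      add_mem' := fun h h' => hadd _ _ h h'
      neg_mem' := fun h => hneg _ h }
  have hω : θ.ω ∈ S := ⟨0, 0, fun z => by simp [θ.add_ω]⟩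
  have hω' : θ.ω' ∈ S := ⟨-(2 * Real.pi * Complex.I / θ.ω), Real.pi * Complex.I, fun z => by
    rw [θ.add_ω', Complex.exp_add, Complex.exp_pi_mul_I]
    ring_nf⟩
  obtain ⟨m, n, rfl⟩ := (θ.mem_lattice_iff l).1 hl
  have := S.add_mem (S.zsmul_mem hω m) (S.zsmul_mem hω' n)
  rw [zsmul_eq_mul, zsmul_eq_mul] at this
  exact this

/-- Simplicity of the zero at 0 is carried to `l` by quasi-periodicity: if θ vanished doubly at `l`,
differentiating θ(z - l) = exp(az + b) θ(z) at `l` would give θ'(0) = 0. -/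
theorem deriv_ne_zero {l : ℂ} (hl : l ∈ L.lattice) : deriv θ.toFun l ≠ 0 := by
  obtain ⟨a, b, h⟩ := θ.exists_add_eq (neg_mem hl)
  intro h0
  have h1 : HasDerivAt (fun z => θ.toFun (z + -l)) (deriv θ.toFun 0) l := by
    have h2 : HasDerivAt θ.toFun (deriv θ.toFun 0) (l + -l) := by
      rw [add_neg_cancel]; exact (θ.differentiable 0).hasDerivAt
    exact h2.comp_add_const l (-l)
  have h3 : HasDerivAt (fun z => Complex.exp (a * z + b) * θ.toFun z) 0 l := by
    have h4 : DifferentiableAt ℂ (fun z : ℂ => Complex.exp (a * z + b)) l := by fun_prop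
    have h5 := h4.hasDerivAt.fun_mul (θ.differentiable l).hasDerivAt
    rw [h0, (θ.eq_zero_iff l).2 hl, mul_zero, mul_zero, add_zero] at h5
    exact h5
  rw [← funext h] at h3
  exact θ.deriv_zero (h1.unique h3)

end ThetaFunction

/-- The lattice is countable, so its complement is dense, and density pulls back along the open map
`l`. -/
theorem ThetaFunction.dense_notMem_lattice {L : PeriodPair} (θ : ThetaFunction L) {n : ℕ}
    {l : (Fin n → ℂ) →L[ℂ] ℂ} {e : Fin n → ℂ} (he : l e = 1) :
    Dense {z : Fin n → ℂ | l z ∉ L.lattice} := by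
  have hopen : IsOpenMap l := l.isOpenMap fun c => ⟨c • e, by simp [he]⟩
  have hc : (L.lattice : Set ℂ).Countable := by
    have : (L.lattice : Set ℂ) ⊆ range fun p : ℤ × ℤ => (p.1 * θ.ω + p.2 * θ.ω' : ℂ) := by
      intro z hz
      obtain ⟨m, n, rfl⟩ := (θ.mem_lattice_iff z).1 hz
      exact ⟨(m, n), rfl⟩
    exact (countable_range _).mono this
  exact (hc.dense_compl ℂ).preimage hopen

/-- A function on an open subset of `ℂ ^ n` which is holomorphic and vanishes where the linear form
`l` takes values in the lattice is a multiple of the theta function of `l`. -/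
theorem ThetaFunction.exists_eq_mul {L : PeriodPair} (θ : ThetaFunction L) {n : ℕ}
    {l : (Fin n → ℂ) →L[ℂ] ℂ} {e : Fin n → ℂ} (he : l e = 1) {W : Set (Fin n → ℂ)} (hW : IsOpen W)
    {h : (Fin n → ℂ) → ℂ} (hd : DifferentiableOn ℂ h W)
    (hv : ∀ z ∈ W, l z ∈ L.lattice → h z = 0) :
    ∃ k : (Fin n → ℂ) → ℂ, DifferentiableOn ℂ k W ∧ ∀ z ∈ W, h z = θ.toFun (l z) * k z := by
  have hdense := θ.dense_notMem_lattice he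
  -- Where `l z₀` is not a period, θ ∘ l is a unit. Otherwise θ ∘ l is locally the linear factor `l
  -- z - l z₀` times a unit, because the zeros are simple, and a translation reduces to division by
  -- a linear form.
  have hloc : ∀ z₀ ∈ W, ∃ k : (Fin n → ℂ) → ℂ, (∀ᶠ z in 𝓝 z₀, DifferentiableAt ℂ k z) ∧
      ∀ᶠ z in 𝓝 z₀, h z = θ.toFun (l z) * k z := by
    intro z₀ hz₀
    by_cases hl : l z₀ ∈ L.lattice
    · have hlz : l (l z₀ • e) = l z₀ := by simp [he]
      have htend : Tendsto (fun y : Fin n → ℂ => y + l z₀ • e) (𝓝 (z₀ - l z₀ • e)) (𝓝 z₀) := by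
        have : ContinuousAt (fun y : Fin n → ℂ => y + l z₀ • e) (z₀ - l z₀ • e) := by fun_prop
        simpa [ContinuousAt] using this
      have htend' : Tendsto (fun y : Fin n → ℂ => y - l z₀ • e) (𝓝 z₀) (𝓝 (z₀ - l z₀ • e)) := by
        have : ContinuousAt (fun y : Fin n → ℂ => y - l z₀ • e) z₀ := by fun_prop
        exact this
      obtain ⟨k, hk, hk'⟩ := exists_eq_linear_mul (h := fun y => h (y + l z₀ • e)) he
        (z₀ := z₀ - l z₀ • e) (by simp [he])
        (by
          filter_upwards [htend.eventually (hW.mem_nhds hz₀)] with y hy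
          have h1 : DifferentiableAt ℂ h (y + l z₀ • e) := hd.differentiableAt (hW.mem_nhds hy)
          exact h1.comp (f := fun y : Fin n → ℂ => y + l z₀ • e) y (by fun_prop))
        (by
          filter_upwards [htend.eventually (hW.mem_nhds hz₀)] with y hy hy0
          exact hv _ hy (by simpa [he, hy0] using hl))
      set d : ℂ → ℂ := dslope θ.toFun (l z₀) with hdd
      have hd1 : Differentiable ℂ d := by
        have := (Complex.differentiableOn_dslope (s := univ) (f := θ.toFun) (c := l z₀)
          univ_mem).2 θ.differentiable.differentiableOn
        exact differentiableOn_univ.1 this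
      have hd0 : d (l z₀) ≠ 0 := by
        rw [hdd, dslope_same]; exact θ.deriv_ne_zero hl
      have hd2 : ∀ w, θ.toFun w = (w - l z₀) * d w := fun w => by
        have := sub_smul_dslope θ.toFun (l z₀) w
        rw [(θ.eq_zero_iff _).2 hl, sub_zero, smul_eq_mul] at this
        exact this.symm
      have hne : ∀ᶠ z in 𝓝 z₀, d (l z) ≠ 0 :=
        ((hd1.continuous.comp l.continuous).continuousAt (x := z₀)).eventually_ne hd0
      refine ⟨fun z => k (z - l z₀ • e) / d (l z), ?_, ?_⟩
      · filter_upwards [htend'.eventually hk, hne] with z hz hz'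
        have h1 : DifferentiableAt ℂ (fun z => k (z - l z₀ • e)) z :=
          DifferentiableAt.comp (f := fun z : Fin n → ℂ => z - l z₀ • e) z hz (by fun_prop)
        have h2 : DifferentiableAt ℂ (fun z => d (l z)) z :=
          DifferentiableAt.fun_comp' z (hd1 _) l.differentiableAt
        simpa only [div_eq_mul_inv] using h1.fun_mul (h2.fun_inv hz')
      · filter_upwards [htend'.eventually hk', hne] with z hz hz'
        simp only [sub_add_cancel, map_sub, hlz] at hz
        rw [hz, hd2]
        field_simp
    · have hne : θ.toFun (l z₀) ≠ 0 := fun h0 => hl ((θ.eq_zero_iff _).1 h0)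
      have hc : ∀ᶠ z in 𝓝 z₀, θ.toFun (l z) ≠ 0 :=
        ((θ.differentiable.continuous.comp l.continuous).continuousAt (x := z₀)).eventually_ne hne
      refine ⟨fun z => h z / θ.toFun (l z), ?_, ?_⟩
      · filter_upwards [hc, hW.mem_nhds hz₀] with z hz hz'
        have h2 : DifferentiableAt ℂ (fun z => θ.toFun (l z)) z :=
          DifferentiableAt.fun_comp' z (θ.differentiable _) l.differentiableAt
        simpa only [div_eq_mul_inv] using
          (hd.differentiableAt (hW.mem_nhds hz')).fun_mul (h2.fun_inv hz)
      · filter_upwards [hc] with z hz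
        field_simp
  set S := {z : Fin n → ℂ | l z ∉ L.lattice}
  have hSne : ∀ z ∈ S, θ.toFun (l z) ≠ 0 := fun z hz h0 => hz ((θ.eq_zero_iff _).1 h0)
  -- The local quotients agree with `h / θ ∘ l` on a dense set, so they glue.
  obtain ⟨h1, h2⟩ := differentiableOn_extendFrom (W := W) (F := fun z => h z / θ.toFun (l z)) hdense
    fun z₀ hz₀ => by
      obtain ⟨k, hk, hk'⟩ := hloc z₀ hz₀
      refine ⟨k, hk, ?_⟩
      filter_upwards [hk'] with z hz hzS
      rw [hz, mul_div_cancel_left₀ _ (hSne z hzS)]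
  refine ⟨_, h1, eqOn_of_dense hdense hW hd.continuousOn
    ((θ.differentiable.continuous.comp l.continuous).continuousOn.mul h1.continuousOn)
    fun z hz hzS => ?_⟩
  rw [h2 z hz hzS, mul_div_cancel₀ _ (hSne z hzS)]

/-! ### The universal covering and its local sections -/

theorem isOpenQuotientMap_proj : IsOpenQuotientMap (proj L g) :=
  IsOpenQuotientMap.piMap fun _ => L.lattice.isOpenQuotientMap_mkQ

theorem proj_surjective : Function.Surjective (proj L g) := isOpenQuotientMap_proj.surjective

theorem continuous_proj : Continuous (proj L g) := isOpenQuotientMap_proj.continuous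

theorem isOpen_preimage_proj (U : Opens (Pow L g)) : IsOpen (proj L g ⁻¹' U) :=
  U.isOpen.preimage continuous_proj

theorem mkQ_eq_zero_iff {z : ℂ} : L.lattice.mkQ z = 0 ↔ z ∈ L.lattice :=
  Submodule.Quotient.mk_eq_zero _

theorem proj_add (z w : Fin g → ℂ) : proj L g (z + w) = proj L g z + proj L g w := by
  funext i; simp [proj]

theorem proj_sub (z w : Fin g → ℂ) : proj L g (z - w) = proj L g z - proj L g w := by
  funext i; simp [proj]

theorem proj_eq_zero_iff {z : Fin g → ℂ} : proj L g z = 0 ↔ ∀ i, z i ∈ L.lattice := by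
  rw [funext_iff]
  exact forall_congr' fun i => mkQ_eq_zero_iff

/-- The lattice is discrete: coordinates of points of a small ball differ by less than the norm of
every nonzero period. -/
theorem exists_injOn_proj (z₀ : Fin g → ℂ) :
    ∃ B : Set (Fin g → ℂ), IsOpen B ∧ z₀ ∈ B ∧ InjOn (proj L g) B := by
  obtain ⟨ε, hε, h⟩ := Metric.mem_nhds_iff.1 (L.compl_lattice_sdiff_singleton_mem_nhds 0)
  refine ⟨ball z₀ (ε / 2), isOpen_ball, mem_ball_self (by positivity), fun z hz w hw hzw => ?_⟩
  have h1 : proj L g (z - w) = 0 := by rw [proj_sub, hzw, sub_self]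
  funext i
  have h2 : ‖z - w‖ < ε := by
    rw [← dist_eq_norm]
    rw [mem_ball] at hz hw
    linarith [dist_triangle_right z w z₀]
  have h3 : z i - w i ∈ ball (0 : ℂ) ε := by
    rw [mem_ball_zero_iff]
    exact (norm_le_pi_norm (z - w) i).trans_lt h2
  have h4 := h h3
  by_contra hne
  exact h4 ⟨proj_eq_zero_iff.1 h1 i, fun h5 => hne (sub_eq_zero.1 h5)⟩

/-- The image in `E ^ g` of an open subset of `ℂ ^ g`. -/
def chart (L : PeriodPair) {B : Set (Fin g → ℂ)} (hB : IsOpen B) : Opens (Pow L g) :=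
  ⟨proj L g '' B, isOpenQuotientMap_proj.isOpenMap B hB⟩

/-- The section over `chart B` of the universal covering with values in `B`. -/
def sect (L : PeriodPair) (B : Set (Fin g → ℂ)) : Pow L g → Fin g → ℂ :=
  Function.invFunOn (proj L g) B

theorem sect_mem {B : Set (Fin g → ℂ)} {hB : IsOpen B} {p : Pow L g} (hp : p ∈ chart L hB) :
    sect L B p ∈ B :=
  Function.invFunOn_mem hp

theorem proj_sect {B : Set (Fin g → ℂ)} {hB : IsOpen B} {p : Pow L g} (hp : p ∈ chart L hB) :
    proj L g (sect L B p) = p :=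
  Function.invFunOn_eq hp

theorem sect_proj {B : Set (Fin g → ℂ)} (hinj : InjOn (proj L g) B) {z : Fin g → ℂ} (hz : z ∈ B) :
    sect L B (proj L g z) = z :=
  hinj.leftInvOn_invFunOn hz

/-- The point `z` need not lie in `B`, only in a period translate of it. Near `z`, projecting and
lifting back is the translation by that fixed period. -/
theorem sect_proj_eventuallyEq {B : Set (Fin g → ℂ)} (hB : IsOpen B) (hinj : InjOn (proj L g) B)
    {z : Fin g → ℂ} (hz : proj L g z ∈ chart L hB) :
    ∀ᶠ y in 𝓝 z, y - (z - sect L B (proj L g z)) ∈ B ∧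
      sect L B (proj L g y) = y - (z - sect L B (proj L g z)) := by
  set l := z - sect L B (proj L g z) with hl
  have hl0 : proj L g l = 0 := by rw [hl, proj_sub, proj_sect hz, sub_self]
  have hc : ContinuousAt (fun y : Fin g → ℂ => y - l) z := by fun_prop
  have hmem : z - l ∈ B := by
    rw [hl, sub_sub_cancel]; exact sect_mem hz
  filter_upwards [hc (hB.mem_nhds hmem)] with y hy
  refine ⟨hy, ?_⟩
  have h1 : proj L g y = proj L g (y - l) := by rw [proj_sub, hl0, sub_zero]
  rw [h1, sect_proj hinj hy]

/-- Composition with a local section turns holomorphic functions on `ℂ ^ g` into holomorphic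
functions on `E ^ g`. -/
theorem HolOn.comp_sect {B : Set (Fin g → ℂ)} {hB : IsOpen B} (hinj : InjOn (proj L g) B)
    {W : Opens (Pow L g)} (hW : W ≤ chart L hB) {F : (Fin g → ℂ) → ℂ}
    (hF : DifferentiableOn ℂ F (B ∩ proj L g ⁻¹' W)) : HolOn W fun p => F (sect L B p) := by
  intro z hz
  have hz' := hW hz
  have hev := sect_proj_eventuallyEq hB hinj hz'
  set l := z - sect L B (proj L g z) with hl
  have heq : (fun p => F (sect L B p)) ∘ proj L g =ᶠ[𝓝 z] fun y => F (y - l) := by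
    filter_upwards [hev] with y hy
    simp [hy.2]
  have hmem : z - l ∈ B ∩ proj L g ⁻¹' W := by
    rw [hl, sub_sub_cancel]
    refine ⟨sect_mem hz', ?_⟩
    rw [mem_preimage, proj_sect hz']
    exact hz
  have h1 : DifferentiableAt ℂ F (z - l) :=
    hF.differentiableAt ((hB.inter (isOpen_preimage_proj W)).mem_nhds hmem)
  have h2 : DifferentiableAt ℂ (fun y => F (y - l)) z :=
    DifferentiableAt.comp (f := fun y : Fin g → ℂ => y - l) z h1 (by fun_prop)
  exact (heq.differentiableAt_iff.2 h2).differentiableWithinAt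

theorem HolOn.continuousOn {U : Opens (Pow L g)} {f : Pow L g → ℂ} (hf : HolOn U f) :
    ContinuousOn f U := by
  intro p hp
  obtain ⟨z, rfl⟩ := proj_surjective p
  have h1 : ContinuousAt (f ∘ proj L g) z :=
    (DifferentiableOn.continuousOn hf).continuousAt ((isOpen_preimage_proj U).mem_nhds hp)
  exact (isOpenQuotientMap_proj.continuousAt_comp_iff.1 h1).continuousWithinAt

theorem HolOn.congr {U : Opens (Pow L g)} {f k : Pow L g → ℂ} (hf : HolOn U f)
    (h : ∀ p ∈ U, k p = f p) : HolOn U k :=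
  DifferentiableOn.congr hf fun _ hz => h _ hz

theorem holOn_of_local {U : Opens (Pow L g)} {f : Pow L g → ℂ}
    (h : ∀ p ∈ U, ∃ V : Opens (Pow L g), p ∈ V ∧ HolOn V f) : HolOn U f := by
  intro z hz
  obtain ⟨V, hV, hf⟩ := h _ hz
  exact (hf.differentiableAt ((isOpen_preimage_proj V).mem_nhds hV)).differentiableWithinAt

theorem HolOn.prod {ι : Type*} (s : Finset ι) {U : Opens (Pow L g)} {f : ι → Pow L g → ℂ}
    (hf : ∀ i, HolOn U (f i)) : HolOn U fun p => ∏ i ∈ s, f i p := by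
  have h : ∀ i, DifferentiableOn ℂ (fun z => f i (proj L g z)) (proj L g ⁻¹' U) := hf
  exact differentiableOn_finsetProd s h

/-! ### Local equations of `Ξ_g` -/

theorem IsEquation.mono {Z : Set (Pow L g)} {V V' : Opens (Pow L g)} (hV : V' ≤ V)
    {f : Pow L g → ℂ} (hf : IsEquation Z V f) : IsEquation Z V' f :=
  ⟨hf.1.mono hV, fun p hp => hf.2.1 p (hV hp), fun W hW => hf.2.2 W (hW.trans hV)⟩

theorem IsLocalEquation.mono {D : EffDivisor L g} {V V' : Opens (Pow L g)} (hV : V' ≤ V)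
    {f : Pow L g → ℂ} (hf : IsLocalEquation D V f) : IsLocalEquation D V' f := by
  obtain ⟨φ, hφ, rfl⟩ := hf
  exact ⟨φ, fun Z hZ => (hφ Z hZ).mono hV, rfl⟩

/-- The theta function of a linear form is an equation of the corresponding hypersurface. -/
theorem ThetaFunction.isEquation (θ : ThetaFunction L) {l : (Fin g → ℂ) →L[ℂ] ℂ} {e : Fin g → ℂ}
    (he : l e = 1) {Z : Set (Pow L g)} (hZ : ∀ z, proj L g z ∈ Z ↔ l z ∈ L.lattice)
    {B : Set (Fin g → ℂ)} {hB : IsOpen B} (hinj : InjOn (proj L g) B) {V : Opens (Pow L g)}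
    (hV : V ≤ chart L hB) : IsEquation Z V fun p => θ.toFun (l (sect L B p)) := by
  refine ⟨HolOn.comp_sect hinj hV (F := fun z => θ.toFun (l z))
    (θ.differentiable.comp l.differentiable).differentiableOn, fun p hp hpZ => ?_,
    fun W hW h hh hv => ?_⟩
  · rw [θ.eq_zero_iff, ← hZ, proj_sect (hV hp)]
    exact hpZ
  · obtain ⟨k, hk, hk'⟩ := θ.exists_eq_mul he (hB.inter (isOpen_preimage_proj W))
      (h := h ∘ proj L g) (DifferentiableOn.mono hh inter_subset_right)
      (fun z hz hl => hv _ hz.2 ((hZ z).2 hl))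
    refine ⟨fun p => k (sect L B p), HolOn.comp_sect hinj (hW.trans hV) hk, fun p hp => ?_⟩
    have hp' := hV (hW hp)
    have h1 := hk' (sect L B p) ⟨sect_mem hp', by rw [mem_preimage, proj_sect hp']; exact hp⟩
    rw [← h1, Function.comp_apply, proj_sect hp']

/-- The hypersurface `π_i ⁻¹ {0}`. -/
abbrev coordZero (L : PeriodPair) {g : ℕ} (i : Fin g) : Set (Pow L g) := {p : Pow L g | p i = 0}

/-- The hypersurface `ker Σ`. -/
abbrev kerSum (L : PeriodPair) (g : ℕ) : Set (Pow L g) := ((sumHom L g).ker : Set (Pow L g))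

theorem mem_support_Xi {Z : Set (Pow L g)} :
    Z ∈ (Xi L g).support ↔ (∃ i, Z = coordZero L i) ∨ Z = kerSum L g := by
  classical
  rw [Finsupp.mem_support_iff, Xi, Theta, Finsupp.add_apply, Finsupp.finsetSum_apply]
  simp only [Finsupp.single_apply, ne_eq, Nat.add_eq_zero_iff, Finset.sum_eq_zero_iff,
    Finset.mem_univ, true_implies, ite_eq_right_iff, one_ne_zero, imp_false]
  rw [not_and_or]
  push Not
  simp only [eq_comm]

theorem supp_Xi : supp (Xi L g) = (⋃ i, coordZero L i) ∪ kerSum L g := by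
  ext p
  simp only [supp, mem_iUnion, mem_support_Xi, mem_union]
  constructor
  · rintro ⟨Z, ⟨i, rfl⟩ | rfl, hp⟩
    · exact Or.inl ⟨i, hp⟩
    · exact Or.inr hp
  · rintro (⟨i, hp⟩ | hp)
    · exact ⟨_, Or.inl ⟨i, rfl⟩, hp⟩
    · exact ⟨_, Or.inr rfl, hp⟩

/-- Exponents add when hypersurfaces coincide, so the formula also covers g = 1, where both
hypersurfaces are {0} and Ξ_1 = 2[0]. -/
theorem Xi_prod (φ : Set (Pow L g) → Pow L g → ℂ) :
    ((Xi L g).prod fun Z n => φ Z ^ n) = (∏ i, φ (coordZero L i)) * φ (kerSum L g) := by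
  rw [Xi, Finsupp.prod_add_index' (by simp) (by intros; exact pow_add _ _ _), Theta,
    ← Finsupp.prod_finsetSum_index (by simp) (by intros; exact pow_add _ _ _)]
  simp

/-- The sum of the coordinates, as a linear form. -/
def sumForm (g : ℕ) : (Fin g → ℂ) →L[ℂ] ℂ := ∑ i, ContinuousLinearMap.proj i

@[simp] theorem sumForm_apply (z : Fin g → ℂ) : sumForm g z = ∑ i, z i := by
  simp [sumForm]

theorem proj_mem_coordZero (z : Fin g → ℂ) (i : Fin g) :
    proj L g z ∈ coordZero L i ↔ (ContinuousLinearMap.proj i : (Fin g → ℂ) →L[ℂ] ℂ) z ∈ L.lattice :=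
  mkQ_eq_zero_iff

theorem proj_mem_kerSum (z : Fin g → ℂ) : proj L g z ∈ kerSum L g ↔ sumForm g z ∈ L.lattice := by
  rw [SetLike.mem_coe, AddMonoidHom.mem_ker, sumForm_apply, ← mkQ_eq_zero_iff, map_sum]
  rfl

/-- The theta function of the divisor `Ξ_g`. -/
def ThetaFunction.xi (θ : ThetaFunction L) (g : ℕ) (z : Fin g → ℂ) : ℂ :=
  (∏ i, θ.toFun (z i)) * θ.toFun (∑ i, z i)

theorem ThetaFunction.xi_eq_zero_iff (θ : ThetaFunction L) (z : Fin g → ℂ) :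
    θ.xi g z = 0 ↔ proj L g z ∈ supp (Xi L g) := by
  rw [ThetaFunction.xi, mul_eq_zero, Finset.prod_eq_zero_iff, supp_Xi, mem_union, mem_iUnion,
    proj_mem_kerSum, θ.eq_zero_iff, sumForm_apply]
  simp only [proj_mem_coordZero, θ.eq_zero_iff, Finset.mem_univ, true_and]
  rfl

/-- Over a chart, the local equations of `Ξ_g` are the unit multiples of its theta function. -/
theorem ThetaFunction.exists_xi_eq_mul (θ : ThetaFunction L) (hg : 1 ≤ g) {B : Set (Fin g → ℂ)}
    {hB : IsOpen B} (hinj : InjOn (proj L g) B) {V : Opens (Pow L g)} (hV : V ≤ chart L hB)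
    {f : Pow L g → ℂ} (hf : IsLocalEquation (Xi L g) V f) :
    (∃ k, HolOn V k ∧ ∀ p ∈ V, θ.xi g (sect L B p) = f p * k p) ∧
      ∃ k, HolOn V k ∧ ∀ p ∈ V, f p = θ.xi g (sect L B p) * k p := by
  obtain ⟨φ, hφ, rfl⟩ := hf
  have he : ∀ i : Fin g, (ContinuousLinearMap.proj i : (Fin g → ℂ) →L[ℂ] ℂ) (Pi.single i 1) = 1 :=
    fun i => by simp
  have he' : sumForm g (Pi.single ⟨0, hg⟩ 1) = 1 := by simp
  have h1 := fun i => θ.isEquation (he i) (fun z => proj_mem_coordZero z i) hinj hV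
  have h2 := θ.isEquation he' proj_mem_kerSum hinj hV
  -- For each component, the given equation and the theta function generate the same ideal, so each
  -- divides the other. Multiplying these relations over the components gives both claims.
  have h1' := fun i => hφ (coordZero L i) (mem_support_Xi.2 (Or.inl ⟨i, rfl⟩))
  have h2' := hφ (kerSum L g) (mem_support_Xi.2 (Or.inr rfl))
  rw [Xi_prod]
  constructor
  · choose k hk hk' using fun i => (h1' i).2.2 V le_rfl _ (h1 i).1 (h1 i).2.1
    obtain ⟨k₀, hk₀, hk₀'⟩ := h2'.2.2 V le_rfl _ h2.1 h2.2.1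
    refine ⟨_, (HolOn.prod Finset.univ hk).mul hk₀, fun p hp => ?_⟩
    have h3 := fun i => hk' i p hp
    have h4 := hk₀' p hp
    simp only [ContinuousLinearMap.proj_apply, sumForm_apply] at h3 h4
    simp only [ThetaFunction.xi, h3, h4, Finset.prod_mul_distrib, Pi.mul_apply, Finset.prod_apply]
    ring
  · choose k hk hk' using fun i => (h1 i).2.2 V le_rfl _ (h1' i).1 (h1' i).2.1
    obtain ⟨k₀, hk₀, hk₀'⟩ := h2.2.2 V le_rfl _ h2'.1 h2'.2.1
    refine ⟨_, (HolOn.prod Finset.univ hk).mul hk₀, fun p hp => ?_⟩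
    have h3 := fun i => hk' i p hp
    have h4 := hk₀' p hp
    simp only [ContinuousLinearMap.proj_apply, sumForm_apply] at h3 h4
    simp only [ThetaFunction.xi, h3, h4, Finset.prod_mul_distrib, Pi.mul_apply, Finset.prod_apply]
    ring

/-- The condition defining the sections of `lineBundle` ranges over local equations. It has content
only because these exist over small open sets. -/
theorem ThetaFunction.exists_isLocalEquation (θ : ThetaFunction L) (hg : 1 ≤ g)
    {B : Set (Fin g → ℂ)} {hB : IsOpen B} (hinj : InjOn (proj L g) B) {V : Opens (Pow L g)}
    (hV : V ≤ chart L hB) : ∃ f, IsLocalEquation (Xi L g) V f := by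
  have h : ∀ Z : Set (Pow L g), ∃ φ : Pow L g → ℂ, Z ∈ (Xi L g).support → IsEquation Z V φ := by
    intro Z
    by_cases hZ : Z ∈ (Xi L g).support
    · rcases mem_support_Xi.1 hZ with ⟨i, rfl⟩ | rfl
      · exact ⟨_, fun _ => θ.isEquation (e := Pi.single i 1) (by simp)
          (fun z => proj_mem_coordZero z i) hinj hV⟩
      · exact ⟨_, fun _ => θ.isEquation (e := Pi.single ⟨0, hg⟩ 1) (by simp)
          proj_mem_kerSum hinj hV⟩
    · exact ⟨0, fun h => absurd h hZ⟩
  choose φ hφ using h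
  exact ⟨_, φ, hφ, rfl⟩

/-! ### Theta factors -/

/-- An entire function on `ℂ ^ g`, not vanishing on a dense set, which gets multiplied by units
under the translations by periods. -/
structure IsThetaLike (L : PeriodPair) (Θ : (Fin g → ℂ) → ℂ) : Prop where
  differentiable : Differentiable ℂ Θ
  dense : Dense {z | Θ z ≠ 0}
  exists_factor : ∀ l, proj L g l = 0 → ∃ J : (Fin g → ℂ) → ℂ, Differentiable ℂ J ∧
    (∀ z, J z ≠ 0) ∧ ∀ z, Θ (z + l) = J z * Θ z

theorem IsThetaLike.comp_add {Θ : (Fin g → ℂ) → ℂ} (h : IsThetaLike L Θ) (c : Fin g → ℂ) :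
    IsThetaLike L fun z => Θ (z + c) where
  differentiable := h.differentiable.comp (differentiable_id.add_const c)
  dense := h.dense.preimage (Homeomorph.addRight c).isOpenMap
  exists_factor l hl := by
    obtain ⟨J, hJ, hJ0, hJ'⟩ := h.exists_factor l hl
    refine ⟨fun z => J (z + c), hJ.comp (differentiable_id.add_const c), fun z => hJ0 _,
      fun z => ?_⟩
    rw [← hJ', add_right_comm]

theorem IsThetaLike.eq_zero_iff_of_proj_eq {Θ : (Fin g → ℂ) → ℂ} (h : IsThetaLike L Θ)
    {z w : Fin g → ℂ} (hzw : proj L g z = proj L g w) : Θ z = 0 ↔ Θ w = 0 := by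
  obtain ⟨J, -, hJ0, hJ'⟩ := h.exists_factor (z - w) (by rw [proj_sub, hzw, sub_self])
  have := hJ' w
  rw [add_sub_cancel] at this
  simp [this, hJ0]

theorem ThetaFunction.exists_factor (θ : ThetaFunction L) {l : ℂ} (hl : l ∈ L.lattice) :
    ∃ J : ℂ → ℂ, Differentiable ℂ J ∧ (∀ z, J z ≠ 0) ∧
      ∀ z, θ.toFun (z + l) = J z * θ.toFun z := by
  obtain ⟨a, b, h⟩ := θ.exists_add_eq hl
  exact ⟨fun z => Complex.exp (a * z + b), by fun_prop, fun z => Complex.exp_ne_zero _, h⟩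

theorem ThetaFunction.isThetaLike_xi (θ : ThetaFunction L) (hg : 1 ≤ g) :
    IsThetaLike L (θ.xi g) where
  differentiable := by
    have h1 : ∀ i : Fin g, Differentiable ℂ fun z : Fin g → ℂ => θ.toFun (z i) := fun i =>
      θ.differentiable.comp (differentiable_apply i)
    have h2 : Differentiable ℂ fun z : Fin g → ℂ => θ.toFun (∑ i, z i) :=
      θ.differentiable.comp (by fun_prop)
    exact (differentiableOn_univ.1 (differentiableOn_finsetProd _ fun i =>
      (h1 i).differentiableOn)).mul h2
  dense := by
    have key : ∀ (l : (Fin g → ℂ) →L[ℂ] ℂ) (e : Fin g → ℂ), l e = 1 →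
        Dense {z : Fin g → ℂ | l z ∉ L.lattice} ∧ IsOpen {z : Fin g → ℂ | l z ∉ L.lattice} :=
      fun l e he => ⟨θ.dense_notMem_lattice he,
        L.isClosed_lattice.isOpen_compl.preimage l.continuous⟩
    have h1 := fun i : Fin g => key (ContinuousLinearMap.proj i) (Pi.single i 1) (by simp)
    have h2 := key (sumForm g) (Pi.single ⟨0, hg⟩ 1) (by simp)
    have h3 := (dense_iInter_of_isOpen (fun i => (h1 i).2) fun i => (h1 i).1).inter_of_isOpen_right
      h2.1 h2.2
    refine h3.mono ?_
    rintro z ⟨hz, hz'⟩ h0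
    rw [θ.xi_eq_zero_iff, supp_Xi, mem_union, mem_iUnion, proj_mem_kerSum] at h0
    rcases h0 with ⟨i, hi⟩ | h0
    · exact mem_iInter.1 hz i ((proj_mem_coordZero z i).1 hi)
    · exact hz' h0
  exists_factor l hl := by
    rw [proj_eq_zero_iff] at hl
    choose J hJ hJ0 hJ' using fun i => θ.exists_factor (hl i)
    obtain ⟨J₀, hJ₀, hJ₀0, hJ₀'⟩ := θ.exists_factor (L.lattice.sum_mem fun i (_ : i ∈ Finset.univ) =>
      hl i)
    have h1 : ∀ i : Fin g, Differentiable ℂ fun z : Fin g → ℂ => J i (z i) := fun i =>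
      (hJ i).comp (differentiable_apply i)
    have h2 : Differentiable ℂ fun z : Fin g → ℂ => J₀ (∑ i, z i) := hJ₀.comp (by fun_prop)
    refine ⟨_, (differentiableOn_univ.1 (differentiableOn_finsetProd Finset.univ fun i =>
      (h1 i).differentiableOn)).mul h2,
      fun z => mul_ne_zero (Finset.prod_ne_zero_iff.2 fun i _ => hJ0 i _) (hJ₀0 _), fun z => ?_⟩
    simp only [ThetaFunction.xi, Pi.add_apply, Pi.mul_apply, Finset.sum_add_distrib, hJ', hJ₀',
      Finset.prod_mul_distrib]
    ring

/-! ### Sections of line bundles as quotients by theta functions -/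

/-- `s` is, over `U`, the quotient by `Θ` of a holomorphic function on the preimage of `U`, with
the value zero where `Θ` vanishes, and it is extended by zero. -/
def IsQuotient (Θ : (Fin g → ℂ) → ℂ) (U : Opens (Pow L g)) (s : Pow L g → ℂ) : Prop :=
  (∀ p, p ∉ U → s p = 0) ∧ ∃ T : (Fin g → ℂ) → ℂ, DifferentiableOn ℂ T (proj L g ⁻¹' U) ∧
    ∀ z, proj L g z ∈ U → s (proj L g z) = T z / Θ z

/-- The sections of `F` are the quotients by `Θ`. -/
def IsPresentation (F : FunSheaf L g) (Θ : (Fin g → ℂ) → ℂ) : Prop :=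
  ∀ U s, s ∈ F.sec U ↔ IsQuotient Θ U s

/-- Over a chart, ξ and any local equation f divide each other, so ξs extends holomorphically
exactly when fs does. The local extensions glue because the complement of the support is dense. The
convention T/0 = 0 matches the value zero of sections on the support. -/
theorem ThetaFunction.isPresentation_Xi (θ : ThetaFunction L) (hg : 1 ≤ g) :
    IsPresentation (lineBundle (Xi L g)) (θ.xi g) := by
  intro U s
  have hΘ := θ.isThetaLike_xi (g := g) hg
  set S : Set (Fin g → ℂ) := {z | θ.xi g z ≠ 0} with hSdef
  have hS : ∀ z, z ∈ S ↔ proj L g z ∉ supp (Xi L g) := fun z => not_congr (θ.xi_eq_zero_iff z)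
  constructor
  · rintro ⟨h0, hs⟩
    refine ⟨fun p hp => h0 p (Or.inl hp), ?_⟩
    obtain ⟨h1, h2⟩ := differentiableOn_extendFrom (W := proj L g ⁻¹' U)
      (F := fun z => θ.xi g z * s (proj L g z)) hΘ.dense fun z₀ hz₀ => by
        obtain ⟨B, hB, hz₀B, hinj⟩ := exists_injOn_proj (L := L) z₀
        set V := chart L hB ⊓ U with hVdef
        have hV : V ≤ chart L hB := inf_le_left
        obtain ⟨f, hf⟩ := θ.exists_isLocalEquation hg hinj hV
        obtain ⟨⟨k, hk, hk'⟩, -⟩ := θ.exists_xi_eq_mul hg hinj hV hf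
        obtain ⟨k₀, hk₀, hk₀'⟩ := hs V inf_le_right f hf
        have hmem : ∀ᶠ z in 𝓝 z₀, z ∈ B ∩ proj L g ⁻¹' U :=
          (hB.inter (isOpen_preimage_proj U)).mem_nhds ⟨hz₀B, hz₀⟩
        refine ⟨(k * k₀) ∘ proj L g, ?_, ?_⟩
        · filter_upwards [hmem] with z hz
          exact (hk.mul hk₀).differentiableAt
            ((isOpen_preimage_proj V).mem_nhds ⟨mem_image_of_mem _ hz.1, hz.2⟩)
        · filter_upwards [hmem] with z hz hzS
          have hzV : proj L g z ∈ V := ⟨mem_image_of_mem _ hz.1, hz.2⟩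
          have h3 := hk' _ hzV
          rw [sect_proj hinj hz.1] at h3
          simp only [Function.comp_apply, Pi.mul_apply]
          rw [← hk₀' _ hzV ((hS z).1 hzS), h3]
          ring
    refine ⟨_, h1, fun z hz => ?_⟩
    by_cases hzS : z ∈ S
    · rw [h2 z hz hzS, mul_div_cancel_left₀ _ hzS]
    · have hzS' : θ.xi g z = 0 := not_not.1 hzS
      rw [hzS', div_zero]
      exact h0 _ (Or.inr ((θ.xi_eq_zero_iff z).1 hzS'))
  · rintro ⟨h0, T, hT, hs⟩
    refine ⟨fun p hp => ?_, fun V hV f hf => ?_⟩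
    · by_cases hpU : p ∈ U
      · obtain ⟨z, rfl⟩ := proj_surjective p
        rw [hs z hpU, (θ.xi_eq_zero_iff z).2 (hp.resolve_left (not_not.2 hpU)), div_zero]
      · exact h0 p hpU
    · have hdense : Dense (supp (Xi L g))ᶜ := by
        refine (proj_surjective.denseRange.dense_image continuous_proj hΘ.dense).mono ?_
        rintro _ ⟨z, hz, rfl⟩
        exact (hS z).1 hz
      have key : ∀ p ∈ V, ∃ V' : Opens (Pow L g), p ∈ V' ∧ ∃ k, HolOn V' k ∧
          ∀ q ∈ V', q ∈ (supp (Xi L g))ᶜ → f q * s q = k q := by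
        intro p hp
        obtain ⟨z₀, rfl⟩ := proj_surjective p
        obtain ⟨B, hB, hz₀B, hinj⟩ := exists_injOn_proj (L := L) z₀
        set V' := chart L hB ⊓ V with hVdef
        have hV' : V' ≤ chart L hB := inf_le_left
        obtain ⟨-, k, hk, hk'⟩ := θ.exists_xi_eq_mul hg hinj hV' (hf.mono inf_le_right)
        refine ⟨V', ⟨mem_image_of_mem _ hz₀B, hp⟩, _, hk.mul (HolOn.comp_sect hinj hV'
          (F := T) (hT.mono fun z hz => hV hz.2.2)), fun q hq hqS => ?_⟩
        have h3 : proj L g (sect L B q) = q := proj_sect (hV' hq)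
        have h4 := hs (sect L B q) (by rw [h3]; exact hV hq.2)
        have h5 : θ.xi g (sect L B q) ≠ 0 := by
          rw [Ne, θ.xi_eq_zero_iff, h3]; exact hqS
        rw [h3] at h4
        rw [hk' q hq, h4, Pi.mul_apply]
        field_simp
      refine ⟨extendFrom (supp (Xi L g))ᶜ fun p => f p * s p, ?_, fun p hp hpS => ?_⟩
      · refine holOn_of_local fun p hp => ?_
        obtain ⟨V', hpV', k, hk, hk'⟩ := key p hp
        exact ⟨V', hpV', hk.congr (extendFrom_eqOn hdense V'.isOpen hk.continuousOn hk')⟩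
      · obtain ⟨V', hpV', k, hk, hk'⟩ := key p hp
        rw [extendFrom_eqOn hdense V'.isOpen hk.continuousOn hk' p hpV', hk' p hpV' hpS]

theorem IsPresentation.pullback {F : FunSheaf L g} {Θ : (Fin g → ℂ) → ℂ} (h : IsPresentation F Θ)
    (c : Fin g → ℂ) : IsPresentation (pullback (proj L g c) F) fun z => Θ (z + c) := by
  intro U s
  rw [mem_pullback, h]
  have hmem : ∀ z, proj L g (z + c) ∈ translate (proj L g c) U ↔ proj L g z ∈ U := fun z => by
    change proj L g (z + c) - proj L g c ∈ U ↔ _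
    rw [proj_add, add_sub_cancel_right]
  constructor
  · rintro ⟨h0, T, hT, hs⟩
    refine ⟨fun p hp => ?_, fun z => T (z + c), ?_, fun z hz => ?_⟩
    · simpa using h0 (p + proj L g c) (by
        change ¬ p + proj L g c - proj L g c ∈ U
        rwa [add_sub_cancel_right])
    · exact DifferentiableOn.comp (t := proj L g ⁻¹' translate (proj L g c) U) hT
        (f := fun z : Fin g → ℂ => z + c) (by fun_prop) fun z hz => (hmem z).2 hz
    · have := hs (z + c) ((hmem z).2 hz)
      simpa only [proj_add, add_sub_cancel_right] using this
  · rintro ⟨h0, T, hT, hs⟩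
    have hmem' : ∀ z, proj L g z ∈ translate (proj L g c) U → proj L g (z - c) ∈ U := fun z hz => by
      rw [← hmem, sub_add_cancel]; exact hz
    refine ⟨fun p hp => h0 _ hp, fun z => T (z - c), ?_, fun z hz => ?_⟩
    · exact DifferentiableOn.comp (t := proj L g ⁻¹' U) hT
        (f := fun z : Fin g → ℂ => z - c) (by fun_prop) hmem'
    · have := hs (z - c) (hmem' z hz)
      simpa only [proj_sub, sub_add_cancel] using this

/-! ### Comparison of line bundles given by theta functions -/

theorem isOpen_image_ne_zero {Θ : (Fin g → ℂ) → ℂ} (h : IsThetaLike L Θ) :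
    IsOpen (proj L g '' {z | Θ z ≠ 0}) :=
  isOpenQuotientMap_proj.isOpenMap _ (isOpen_ne_fun h.differentiable.continuous continuous_const)

/-- If `E Θ₁ / Θ₂` is periodic, then the quotients by `Θ₁` and by `Θ₂` correspond. -/
theorem IsQuotient.exists_mul {Θ₁ Θ₂ E : (Fin g → ℂ) → ℂ} (h₁ : IsThetaLike L Θ₁)
    (h₂ : IsThetaLike L Θ₂) (hE : Differentiable ℂ E)
    (hper : ∀ z l, proj L g l = 0 → E (z + l) * Θ₁ (z + l) * Θ₂ z = E z * Θ₁ z * Θ₂ (z + l))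
    {U : Opens (Pow L g)} {s : Pow L g → ℂ} (hs : IsQuotient Θ₁ U s) :
    ∃ t, IsQuotient Θ₂ U t ∧
      ∀ z, Θ₁ z ≠ 0 → Θ₂ z ≠ 0 → Θ₂ z * t (proj L g z) = E z * Θ₁ z * s (proj L g z) := by
  classical
  obtain ⟨h0, T, hT, hs⟩ := hs
  have hW : ∀ l, proj L g l = 0 → (fun z => z + l) ⁻¹' (proj L g ⁻¹' U) = proj L g ⁻¹' U :=
    fun l hl => by
      ext z
      simp [proj_add, hl]
  -- This is the periodicity of E T / Θ₂ with denominators cleared. It follows from `hper` where Θ₁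
  -- ≠ 0, since T = Θ₁ s there, and elsewhere by density.
  have hauto : ∀ l, proj L g l = 0 → ∀ z ∈ proj L g ⁻¹' U,
      E (z + l) * T (z + l) * Θ₂ z = E z * T z * Θ₂ (z + l) := by
    intro l hl
    have hTl : ContinuousOn (fun z => T (z + l)) (proj L g ⁻¹' U) := by
      have h3 : ContinuousOn (fun z : Fin g → ℂ => z + l) (proj L g ⁻¹' U) := by fun_prop
      exact hT.continuousOn.comp h3 fun z hz => by
        have : z ∈ (fun z => z + l) ⁻¹' (proj L g ⁻¹' U) := by rw [hW l hl]; exact hz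
        exact this
    have hadd : Continuous fun z : Fin g → ℂ => z + l := by fun_prop
    refine eqOn_of_dense h₁.dense (isOpen_preimage_proj U)
      ((((hE.continuous.comp hadd).continuousOn).mul hTl).mul h₂.differentiable.continuous.continuousOn)
      ((hE.continuous.continuousOn.mul hT.continuousOn).mul
        (h₂.differentiable.continuous.comp hadd).continuousOn) fun z hz hz1 => ?_
    have hpl : proj L g (z + l) = proj L g z := by rw [proj_add, hl, add_zero]
    have hz1' : Θ₁ (z + l) ≠ 0 := fun h => hz1 ((h₁.eq_zero_iff_of_proj_eq hpl).1 h)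
    have h3 : T z = Θ₁ z * s (proj L g z) := by rw [hs z hz, mul_div_cancel₀ _ hz1]
    have h4 : T (z + l) = Θ₁ (z + l) * s (proj L g z) := by
      rw [← hpl, hs (z + l) (by rw [hpl]; exact hz), mul_div_cancel₀ _ hz1']
    simp only [h3, h4]
    linear_combination s (proj L g z) * hper z l hl
  -- The lifts are arbitrary; `hauto` makes the value of `t` independent of them.
  set σ : Pow L g → Fin g → ℂ := Function.surjInv proj_surjective
  have hσ : ∀ p, proj L g (σ p) = p := Function.surjInv_eq proj_surjective
  set t : Pow L g → ℂ := fun p => if p ∈ U then E (σ p) * T (σ p) / Θ₂ (σ p) else 0 with ht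
  have htz : ∀ z, proj L g z ∈ U → t (proj L g z) = E z * T z / Θ₂ z := by
    intro z hz
    simp only [ht, if_pos hz]
    have h3 := hauto (σ (proj L g z) - z) (by rw [proj_sub, hσ, sub_self]) z hz
    rw [add_sub_cancel] at h3
    have h4 := h₂.eq_zero_iff_of_proj_eq (hσ (proj L g z))
    by_cases h5 : Θ₂ z = 0
    · rw [h5, h4.2 h5, div_zero, div_zero]
    · have h6 : Θ₂ (σ (proj L g z)) ≠ 0 := fun h => h5 (h4.1 h)
      rw [div_eq_div_iff h6 h5, h3]
  refine ⟨t, ⟨fun p hp => if_neg hp, fun z => E z * T z, hE.differentiableOn.mul hT, htz⟩,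
    fun z hz1 hz2 => ?_⟩
  by_cases hz : proj L g z ∈ U
  · rw [htz z hz, hs z hz]
    field_simp
  · rw [h0 _ hz, ht]
    simp [hz]

theorem IsQuotient.exists_continuousOn {Θ : (Fin g → ℂ) → ℂ} {U : Opens (Pow L g)}
    {s : Pow L g → ℂ} (hs : IsQuotient Θ U s) : ∃ T : (Fin g → ℂ) → ℂ,
      ContinuousOn T (proj L g ⁻¹' U) ∧
      (∀ z, Θ z ≠ 0 → proj L g z ∈ U → Θ z * s (proj L g z) = T z) ∧
      ∀ z, s (proj L g z) = (proj L g ⁻¹' U).indicator (fun z => T z / Θ z) z := by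
  classical
  obtain ⟨h0, T, hT, hs⟩ := hs
  refine ⟨T, hT.continuousOn, fun z hz hzU => by rw [hs z hzU, mul_div_cancel₀ _ hz], fun z => ?_⟩
  by_cases hz : z ∈ proj L g ⁻¹' U
  · rw [indicator_of_mem hz, hs z hz]
  · rw [indicator_of_notMem hz, h0 _ hz]

/-- Quotients are determined by their values on a dense set. -/
theorem IsQuotient.ext {Θ : (Fin g → ℂ) → ℂ} {D : Set (Fin g → ℂ)} (hD : Dense D)
    (hDΘ : ∀ z ∈ D, Θ z ≠ 0) {U : Opens (Pow L g)} {s t : Pow L g → ℂ} (hs : IsQuotient Θ U s)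
    (ht : IsQuotient Θ U t) (h : ∀ z ∈ D, s (proj L g z) = t (proj L g z)) : s = t := by
  obtain ⟨T, hT, hsT, hs'⟩ := hs.exists_continuousOn
  obtain ⟨T', hT', htT, ht'⟩ := ht.exists_continuousOn
  have heq := eqOn_of_dense hD (isOpen_preimage_proj U) hT hT' fun z hz hzD => by
    rw [← hsT z (hDΘ z hzD) hz, ← htT z (hDΘ z hzD) hz, h z hzD]
  funext p
  obtain ⟨z, rfl⟩ := proj_surjective p
  rw [hs' z, ht' z]
  by_cases hz : z ∈ proj L g ⁻¹' U
  · rw [indicator_of_mem hz, indicator_of_mem hz, heq z hz]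
  · rw [indicator_of_notMem hz, indicator_of_notMem hz]

theorem IsThetaLike.dense_inter {Θ₁ Θ₂ : (Fin g → ℂ) → ℂ} (h₁ : IsThetaLike L Θ₁)
    (h₂ : IsThetaLike L Θ₂) : Dense {z | Θ₁ z ≠ 0 ∧ Θ₂ z ≠ 0} :=
  h₁.dense.inter_of_isOpen_left h₂.dense
    (isOpen_ne_fun h₁.differentiable.continuous continuous_const)

/-- Line bundles with presentations `Θ₁` and `Θ₂` are isomorphic if `E Θ₁ / Θ₂` is periodic for a
nowhere vanishing entire function `E`. -/
theorem IsPresentation.isomorphic {F₁ F₂ : FunSheaf L g} {Θ₁ Θ₂ E : (Fin g → ℂ) → ℂ}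
    (hF₁ : IsPresentation F₁ Θ₁) (hF₂ : IsPresentation F₂ Θ₂) (h₁ : IsThetaLike L Θ₁)
    (h₂ : IsThetaLike L Θ₂) (hE : Differentiable ℂ E) (hE0 : ∀ z, E z ≠ 0)
    (hper : ∀ z l, proj L g l = 0 → E (z + l) * Θ₁ (z + l) * Θ₂ z = E z * Θ₁ z * Θ₂ (z + l)) :
    Isomorphic F₁ F₂ := by
  classical
  set D : Set (Fin g → ℂ) := {z | Θ₁ z ≠ 0 ∧ Θ₂ z ≠ 0}
  have hD : Dense D := h₁.dense_inter h₂
  -- `R s t` says t = (E Θ₁/Θ₂) s on a dense set. Each of `s` and `t` determines the other, so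
  -- bijectivity, linearity and compatibility with restriction all follow from uniqueness.
  set R : (Pow L g → ℂ) → (Pow L g → ℂ) → Prop := fun s t =>
    ∀ z ∈ D, Θ₂ z * t (proj L g z) = E z * Θ₁ z * s (proj L g z)
  have hex : ∀ U (s : F₁.sec U), ∃ t : F₂.sec U, R s t := fun U s => by
    obtain ⟨t, ht, ht'⟩ := ((hF₁ U s).1 s.2).exists_mul h₁ h₂ hE hper
    exact ⟨⟨t, (hF₂ U t).2 ht⟩, fun z hz => ht' z hz.1 hz.2⟩
  have hex' : ∀ U (t : F₂.sec U), ∃ s : F₁.sec U, R s t := fun U t => by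
    obtain ⟨s, hs, hs'⟩ := ((hF₂ U t).1 t.2).exists_mul h₂ h₁ (hE.inv hE0) fun z l hl => by
      have h3 := hper z l hl
      have h4 := hE0 z
      have h5 := hE0 (z + l)
      simp only [Pi.inv_apply]
      field_simp
      linear_combination -h3
    refine ⟨⟨s, (hF₁ U s).2 hs⟩, fun z hz => ?_⟩
    have h3 := hs' z hz.2 hz.1
    have h4 := hE0 z
    rw [Pi.inv_apply] at h3
    field_simp at h3
    linear_combination -h3
  have huniq : ∀ U (s : F₁.sec U) (t t' : F₂.sec U), R s t → R s t' → t = t' :=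
    fun U s t t' h h' => Subtype.ext <|
      IsQuotient.ext hD (fun z hz => hz.2) ((hF₂ U t).1 t.2) ((hF₂ U t').1 t'.2) fun z hz =>
        mul_left_cancel₀ hz.2 ((h z hz).trans (h' z hz).symm)
  have huniq' : ∀ U (s s' : F₁.sec U) (t : F₂.sec U), R s t → R s' t → s = s' :=
    fun U s s' t h h' => Subtype.ext <|
      IsQuotient.ext hD (fun z hz => hz.1) ((hF₁ U s).1 s.2) ((hF₁ U s').1 s'.2) fun z hz =>
        mul_left_cancel₀ (mul_ne_zero (hE0 z) hz.1) ((h z hz).symm.trans (h' z hz))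
  choose a ha using hex
  choose b hb using hex'
  refine ⟨fun U =>
    { toFun := a U
      invFun := b U
      left_inv := fun s => huniq' U _ _ _ (hb U _) (ha U s)
      right_inv := fun t => huniq U _ _ _ (ha U _) (hb U t)
      map_add' := fun s s' => huniq U _ _ _ (ha U _) fun z hz => ?_ },
    fun U f hf s => huniq U _ _ _ (ha U _) fun z hz => ?_,
    fun U V hV s => huniq V _ _ _ (ha V _) fun z hz => ?_⟩
  · have h3 := ha U s z hz
    have h4 := ha U s' z hz
    simp only [AddSubgroup.coe_add, Pi.add_apply]
    linear_combination h3 + h4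
  · have h3 := ha U s z hz
    simp only [AddEquiv.coe_mk, Equiv.coe_fn_mk, Pi.mul_apply]
    linear_combination f (proj L g z) * h3
  · have h3 := ha U s z hz
    by_cases hzV : proj L g z ∈ (V : Set (Pow L g))
    · simp only [AddEquiv.coe_mk, Equiv.coe_fn_mk, indicator_of_mem hzV]
      exact h3
    · simp only [AddEquiv.coe_mk, Equiv.coe_fn_mk, indicator_of_notMem hzV, mul_zero]

/-- The constant section `1` of the line bundle given by `Θ`. -/
def oneSection (L : PeriodPair) (Θ : (Fin g → ℂ) → ℂ) : Pow L g → ℂ :=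
  (proj L g '' {z | Θ z ≠ 0}).indicator 1

theorem IsThetaLike.oneSection_of_ne {Θ : (Fin g → ℂ) → ℂ} {z : Fin g → ℂ} (hz : Θ z ≠ 0) :
    oneSection L Θ (proj L g z) = 1 :=
  indicator_of_mem (mem_image_of_mem _ hz) _

theorem IsThetaLike.oneSection_proj {Θ : (Fin g → ℂ) → ℂ} (h : IsThetaLike L Θ)
    (z : Fin g → ℂ) : oneSection L Θ (proj L g z) = Θ z / Θ z := by
  by_cases hz : Θ z = 0
  · rw [hz, div_zero]
    refine indicator_of_notMem ?_ _
    rintro ⟨w, hw, hwz⟩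
    exact hw ((h.eq_zero_iff_of_proj_eq hwz).2 hz)
  · rw [oneSection_of_ne hz, div_self hz]

theorem IsThetaLike.isQuotient_oneSection {Θ : (Fin g → ℂ) → ℂ} (h : IsThetaLike L Θ) :
    IsQuotient Θ ⊤ (oneSection L Θ) :=
  ⟨fun _ hp => absurd trivial hp, Θ, h.differentiable.differentiableOn,
    fun z _ => h.oneSection_proj z⟩

/-- The local generator `1 / Θ` over a chart. -/
theorem IsThetaLike.isQuotient_inv {Θ : (Fin g → ℂ) → ℂ} (h : IsThetaLike L Θ)
    {B : Set (Fin g → ℂ)} (hB : IsOpen B) (hinj : InjOn (proj L g) B) :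
    IsQuotient Θ (chart L hB) ((chart L hB : Set (Pow L g)).indicator
      fun p => (Θ (sect L B p))⁻¹) := by
  have hJ : ∀ l : Fin g → ℂ, ∃ J : (Fin g → ℂ) → ℂ, proj L g l = 0 → Differentiable ℂ J ∧
      (∀ z, J z ≠ 0) ∧ ∀ z, Θ (z + l) = J z * Θ z := fun l => by
    by_cases hl : proj L g l = 0
    · obtain ⟨J, hJ⟩ := h.exists_factor l hl
      exact ⟨J, fun _ => hJ⟩
    · exact ⟨0, fun hl' => absurd hl' hl⟩
  choose J hJ using hJ
  have hper : ∀ z, proj L g z ∈ chart L hB → proj L g (z - sect L B (proj L g z)) = 0 :=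
    fun z hz => by rw [proj_sub, proj_sect hz, sub_self]
  -- The numerator has to be Θ(z)/Θ(w), where w is the lift in `B`. This is the automorphy factor at
  -- w of the period z - w, which is locally constant in z.
  refine ⟨fun p hp => indicator_of_notMem hp _,
    fun z => J (z - sect L B (proj L g z)) (sect L B (proj L g z)), fun z hz => ?_, fun z hz => ?_⟩
  · have hev := sect_proj_eventuallyEq hB hinj hz
    set l := z - sect L B (proj L g z)
    have h1 : DifferentiableAt ℂ (fun y => J l (y - l)) z :=
      ((hJ l (hper z hz)).1.comp (differentiable_id.sub_const l)) z
    refine (EventuallyEq.differentiableAt_iff ?_).2 h1 |>.differentiableWithinAt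
    filter_upwards [hev] with y hy
    rw [hy.2, sub_sub_cancel]
  · obtain ⟨-, h2, h3⟩ := hJ _ (hper z hz)
    have h4 := h3 (sect L B (proj L g z))
    rw [add_sub_cancel] at h4
    rw [indicator_of_mem (show proj L g z ∈ (chart L hB : Set (Pow L g)) from hz)]
    rw [h4, div_mul_eq_div_div, div_self (h2 _), one_div]

/-- An isomorphism from the line bundle of `Θ₁` to that of `Θ₂` sends the section `1` to `u` such
that `Θ₂ u / Θ₁` is entire. -/
theorem IsPresentation.exists_entire {F₁ F₂ : FunSheaf L g} {Θ₁ Θ₂ : (Fin g → ℂ) → ℂ}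
    (hF₁ : IsPresentation F₁ Θ₁) (hF₂ : IsPresentation F₂ Θ₂) (h₁ : IsThetaLike L Θ₁)
    (h₂ : IsThetaLike L Θ₂) (e : ∀ U, F₁.sec U ≃+ F₂.sec U)
    (he : ∀ (U : Opens (Pow L g)) (f : Pow L g → ℂ) (hf : HolOn U f) (s : F₁.sec U),
      e U ⟨f * s, F₁.mul_mem U f hf s s.2⟩ = ⟨f * e U s, F₂.mul_mem U f hf _ (e U s).2⟩)
    (he' : ∀ (U V : Opens (Pow L g)) (hV : V ≤ U) (s : F₁.sec U),
      e V ⟨Set.indicator V s, F₁.res_mem U V hV s s.2⟩ =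
        ⟨Set.indicator V (e U s), F₂.res_mem U V hV _ (e U s).2⟩)
    (u₁ : F₁.sec ⊤) (hu₁ : (u₁ : Pow L g → ℂ) = oneSection L Θ₁) :
    ∃ H : (Fin g → ℂ) → ℂ, Differentiable ℂ H ∧ ∀ z, Θ₁ z ≠ 0 → Θ₂ z ≠ 0 →
      H z * Θ₁ z = Θ₂ z * (e ⊤ u₁ : Pow L g → ℂ) (proj L g z) := by
  set u : Pow L g → ℂ := (e ⊤ u₁ : Pow L g → ℂ) with hu
  obtain ⟨hd, hH⟩ := differentiableOn_extendFrom (W := univ)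
    (F := fun z => Θ₂ z * u (proj L g z) / Θ₁ z) (h₁.dense_inter h₂) fun z₀ _ => by
      obtain ⟨B, hB, hz₀B, hinj⟩ := exists_injOn_proj (L := L) z₀
      set V := chart L hB
      set s₀ := (V : Set (Pow L g)).indicator fun p => (Θ₁ (sect L B p))⁻¹ with hs₀
      have hs₀m : s₀ ∈ F₁.sec V := (hF₁ V s₀).2 (h₁.isQuotient_inv hB hinj)
      obtain ⟨-, T, hT, hw⟩ := (hF₂ V _).1 (e V ⟨s₀, hs₀m⟩).2
      have hf : HolOn V fun p => Θ₁ (sect L B p) :=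
        HolOn.comp_sect hinj le_rfl h₁.differentiable.differentiableOn
      -- Over the chart, 1 = Θ₁ · (1/Θ₁), so linearity gives u = Θ₁ · e(1/Θ₁) = Θ₁ T/Θ₂. Hence Θ₂
      -- u/Θ₁ is the holomorphic function `T` there.
      have h3 := he V _ hf ⟨s₀, hs₀m⟩
      have h4 := he' ⊤ V le_top u₁
      have h5 : (fun p => Θ₁ (sect L B p)) * s₀ = (V : Set (Pow L g)).indicator u₁ := by
        funext p
        by_cases hp : p ∈ (V : Set (Pow L g))
        · rw [Pi.mul_apply, hs₀, indicator_of_mem hp, indicator_of_mem hp, hu₁]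
          conv_rhs => rw [← proj_sect hp, h₁.oneSection_proj]
          rw [div_eq_mul_inv]
        · rw [Pi.mul_apply, hs₀, indicator_of_notMem hp, indicator_of_notMem hp, mul_zero]
      have h6 : (fun p => Θ₁ (sect L B p)) * (e V ⟨s₀, hs₀m⟩ : Pow L g → ℂ) =
          (V : Set (Pow L g)).indicator u := by
        have h7 := congrArg Subtype.val (h3.symm.trans ((congrArg (e V) (Subtype.ext h5)).trans h4))
        exact h7
      refine ⟨T, ?_, ?_⟩
      · filter_upwards [hB.mem_nhds hz₀B] with z hz
        exact hT.differentiableAt ((isOpen_preimage_proj V).mem_nhds (mem_image_of_mem _ hz))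
      · filter_upwards [hB.mem_nhds hz₀B] with z hz hzD
        have hzV : proj L g z ∈ (V : Set (Pow L g)) := mem_image_of_mem _ hz
        have h7 := congrFun h6 (proj L g z)
        rw [indicator_of_mem hzV, Pi.mul_apply, sect_proj hinj hz, hw z hzV] at h7
        rw [← h7]
        have := hzD.1
        have := hzD.2
        field_simp
  refine ⟨_, differentiableOn_univ.1 hd, fun z hz1 hz2 => ?_⟩
  rw [hH z trivial ⟨hz1, hz2⟩, div_mul_cancel₀ _ hz1]

/-- If line bundles with presentations `Θ₁` and `Θ₂` are isomorphic, then `E Θ₁ / Θ₂` is periodic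
for a nowhere vanishing entire function `E`. -/
theorem IsPresentation.exists_of_isomorphic {F₁ F₂ : FunSheaf L g} {Θ₁ Θ₂ : (Fin g → ℂ) → ℂ}
    (hF₁ : IsPresentation F₁ Θ₁) (hF₂ : IsPresentation F₂ Θ₂) (h₁ : IsThetaLike L Θ₁)
    (h₂ : IsThetaLike L Θ₂) (hiso : Isomorphic F₁ F₂) :
    ∃ E : (Fin g → ℂ) → ℂ, Differentiable ℂ E ∧ (∀ z, E z ≠ 0) ∧
      ∀ z l, proj L g l = 0 → E (z + l) * Θ₁ (z + l) * Θ₂ z = E z * Θ₁ z * Θ₂ (z + l) := by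
  obtain ⟨e, he, he'⟩ := hiso
  set u₁ : F₁.sec ⊤ := ⟨oneSection L Θ₁, (hF₁ _ _).2 h₁.isQuotient_oneSection⟩
  set u₂ : F₂.sec ⊤ := ⟨oneSection L Θ₂, (hF₂ _ _).2 h₂.isQuotient_oneSection⟩
  obtain ⟨H, hH, hHu⟩ := hF₁.exists_entire hF₂ h₁ h₂ e he he' u₁ rfl
  obtain ⟨G, hG, hGv⟩ := hF₂.exists_entire hF₁ h₂ h₁ (fun U => (e U).symm)
    (fun U f hf s => by rw [AddEquiv.symm_apply_eq, he U f hf]; simp)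
    (fun U V hV s => by rw [AddEquiv.symm_apply_eq, he' U V hV]; simp) u₂ rfl
  set u : Pow L g → ℂ := (e ⊤ u₁ : Pow L g → ℂ) with hu
  set v : Pow L g → ℂ := ((e ⊤).symm u₂ : Pow L g → ℂ) with hv
  have hD := h₁.dense_inter h₂
  -- Where Θ₁ ≠ 0 the section `v` is a holomorphic function, so linearity applied to v · 1 = v gives
  -- v · e(1) = e(v), which is the section 1.
  have huv : ∀ z, Θ₁ z ≠ 0 → Θ₂ z ≠ 0 → v (proj L g z) * u (proj L g z) = 1 := by
    set W : Opens (Pow L g) := ⟨proj L g '' {z | Θ₁ z ≠ 0}, isOpen_image_ne_zero h₁⟩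
    have hvW : HolOn W v := by
      obtain ⟨-, T, hT, hvT⟩ := (hF₁ ⊤ v).1 ((e ⊤).symm u₂).2
      have hne : ∀ z ∈ proj L g ⁻¹' W, Θ₁ z ≠ 0 := by
        rintro z ⟨w, hw, hwz⟩ hz
        exact hw ((h₁.eq_zero_iff_of_proj_eq hwz).2 hz)
      have h3 : DifferentiableOn ℂ (fun z => T z * (Θ₁ z)⁻¹) (proj L g ⁻¹' W) :=
        (hT.mono fun _ _ => trivial).mul (h₁.differentiable.differentiableOn.inv hne)
      refine h3.congr fun z _ => ?_
      rw [Function.comp_apply, hvT z trivial, div_eq_mul_inv]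
    have h3 := he W v hvW ⟨_, F₁.res_mem ⊤ W le_top u₁ u₁.2⟩
    have h4 := he' ⊤ W le_top u₁
    have h5 := he' ⊤ W le_top ((e ⊤).symm u₂)
    have h6 : v * (W : Set (Pow L g)).indicator u₁ = (W : Set (Pow L g)).indicator v := by
      funext p
      by_cases hp : p ∈ (W : Set (Pow L g))
      · rw [Pi.mul_apply, indicator_of_mem hp, indicator_of_mem hp,
          show (u₁ : Pow L g → ℂ) p = 1 from indicator_of_mem hp _, mul_one]
      · rw [Pi.mul_apply, indicator_of_notMem hp, indicator_of_notMem hp, mul_zero]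
    have h7 : v * (e W ⟨_, F₁.res_mem ⊤ W le_top u₁ u₁.2⟩ : Pow L g → ℂ) =
        (W : Set (Pow L g)).indicator (e ⊤ ((e ⊤).symm u₂)) :=
      congrArg Subtype.val (h3.symm.trans ((congrArg (e W) (Subtype.ext h6)).trans h5))
    rw [h4, AddEquiv.apply_symm_apply] at h7
    intro z hz1 hz2
    have hzW : proj L g z ∈ (W : Set (Pow L g)) := mem_image_of_mem _ hz1
    have h8 := congrFun h7 (proj L g z)
    simp only [Pi.mul_apply, indicator_of_mem hzW] at h8
    rw [h8]
    exact IsThetaLike.oneSection_of_ne hz2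
  have hHG : ∀ z, H z * G z = 1 := by
    have := eqOn_of_dense (W := univ) hD isOpen_univ (f := fun z => H z * G z) (k := fun _ => 1)
      (hH.continuous.mul hG.continuous).continuousOn continuousOn_const fun z _ hz => by
        have h3 := hHu z hz.1 hz.2
        have h4 := hGv z hz.2 hz.1
        have h5 := huv z hz.1 hz.2
        refine mul_right_cancel₀ (mul_ne_zero hz.1 hz.2) ?_
        linear_combination (G z * Θ₂ z) * h3 + (Θ₂ z * u (proj L g z)) * h4 +
          Θ₁ z * Θ₂ z * h5
    exact fun z => this z trivial
  -- HG = 1 excludes zeros of H, and H Θ₁/Θ₂ is periodic because it equals `u` composed with the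
  -- projection.
  refine ⟨H, hH, fun z hz => by simpa [hz] using hHG z, fun z l hl => ?_⟩
  have hadd : Continuous fun z : Fin g → ℂ => z + l := by fun_prop
  refine eqOn_of_dense (W := univ) hD isOpen_univ
    (f := fun z => H (z + l) * Θ₁ (z + l) * Θ₂ z) (k := fun z => H z * Θ₁ z * Θ₂ (z + l))
    (((hH.continuous.comp hadd).mul (h₁.differentiable.continuous.comp hadd)).mul
      h₂.differentiable.continuous).continuousOn
    ((hH.continuous.mul h₁.differentiable.continuous).mul
      (h₂.differentiable.continuous.comp hadd)).continuousOn (fun z _ hz => ?_) z trivial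
  have hpl : proj L g (z + l) = proj L g z := by rw [proj_add, hl, add_zero]
  have h3 := hHu z hz.1 hz.2
  have h4 := hHu (z + l) (fun h => hz.1 ((h₁.eq_zero_iff_of_proj_eq hpl).1 h))
    (fun h => hz.2 ((h₂.eq_zero_iff_of_proj_eq hpl).1 h))
  rw [hpl] at h4
  simp only [h3, h4]
  ring

/-! ### Nowhere vanishing quasi-periodic functions -/

/-- Entire functions on the complex plane which are periodic for a lattice are constant. -/
theorem ThetaFunction.eq_of_periodic (θ : ThetaFunction L) {f : ℂ → ℂ} (hf : Differentiable ℂ f)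
    (h : ∀ z, f (z + θ.ω) = f z) (h' : ∀ z, f (z + θ.ω') = f z) (z w : ℂ) : f z = f w := by
  let S : AddSubgroup ℂ :=
    { carrier := {l | ∀ z, f (z + l) = f z}
      zero_mem' := fun z => by rw [add_zero]
      add_mem' := fun {l l'} hl hl' z => by rw [← add_assoc, hl', hl]
      neg_mem' := fun {l} hl z => by rw [← hl (z + -l), neg_add_cancel_right] }
  have hS : ∀ l ∈ L.lattice, ∀ z, f (z + l) = f z := fun l hl => by
    obtain ⟨m, n, rfl⟩ := (θ.mem_lattice_iff l).1 hl
    have := S.add_mem (S.zsmul_mem (x := θ.ω) h m) (S.zsmul_mem (x := θ.ω') h' n)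
    rw [zsmul_eq_mul, zsmul_eq_mul] at this
    exact this
  refine hf.apply_eq_apply_of_bounded ?_ z w
  -- Every point is congruent to its fractional part, which lies in this ball. So `f` is bounded and
  -- Liouville's theorem applies.
  obtain ⟨C, hC⟩ := (isCompact_closedBall (0 : ℂ) (∑ i, ‖L.basis i‖)).exists_bound_of_continuousOn
    hf.continuous.continuousOn
  refine isBounded_iff_forall_norm_le.2 ⟨C, ?_⟩
  rintro _ ⟨z, rfl⟩
  have h1 : f (ZSpan.fract L.basis z) = f z := by
    rw [ZSpan.fract_apply, sub_eq_add_neg]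
    refine hS _ (neg_mem ?_) z
    rw [L.lattice_eq_span_range_basis]
    exact (ZSpan.floor L.basis z).2
  rw [← h1]
  exact hC _ (by simpa using ZSpan.norm_fract_le L.basis z)

/-- The multipliers of a nowhere vanishing entire function which is periodic for `ω` and
quasi-periodic for `ω'`. -/
theorem ThetaFunction.exists_multiplier_eq (θ : ThetaFunction L) {f : ℂ → ℂ}
    (hf : Differentiable ℂ f) (hf0 : ∀ z, f z ≠ 0) (h : ∀ z, f (z + θ.ω) = f z) {κ : ℂ}
    (h' : ∀ z, f (z + θ.ω') = κ * f z) :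
    ∃ m : ℤ, κ = Complex.exp (2 * Real.pi * Complex.I * (m * θ.ω' / θ.ω)) := by
  have hdf : Differentiable ℂ (deriv f) :=
    differentiableOn_univ.1 (hf.differentiableOn.deriv isOpen_univ)
  have hder : ∀ z, deriv f (z + θ.ω) = deriv f z := fun z => by
    rw [← deriv_comp_add_const, funext h]
  have hder' : ∀ z, deriv f (z + θ.ω') = κ * deriv f z := fun z => by
    rw [← deriv_comp_add_const, funext h', deriv_const_mul_field]
  have hκ : κ ≠ 0 := fun hκ => hf0 (0 + θ.ω') (by rw [h', hκ, zero_mul])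
  -- The multiplier cancels in the logarithmic derivative, which is entire because `f` has no zeros.
  -- It is therefore constant and `f` is an exponential.
  have hconst := θ.eq_of_periodic (f := fun z => deriv f z / f z) (hdf.div hf hf0)
    (fun z => by rw [hder, h]) (fun z => by rw [hder', h', mul_div_mul_left _ _ hκ])
  set a := deriv f 0 / f 0 with ha
  have hda : ∀ z, deriv f z = a * f z := fun z => by
    rw [ha, ← hconst z 0, div_mul_cancel₀ _ (hf0 z)]
  have hexp : ∀ z, f z = f 0 * Complex.exp (a * z) := by
    have h1 : ∀ z, HasDerivAt (fun z => f z * Complex.exp (-(a * z))) 0 z := fun z => by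
      have h2 : HasDerivAt (fun z : ℂ => -(a * z)) (-a) z := by
        simpa using ((hasDerivAt_id z).const_mul a).fun_neg
      have h3 := (hf z).hasDerivAt.fun_mul h2.cexp
      rw [hda] at h3
      exact h3.congr_deriv (by ring)
    intro z
    have h4 := is_const_of_deriv_eq_zero (fun z => (h1 z).differentiableAt)
      (fun z => (h1 z).deriv) z 0
    simp only [mul_zero, neg_zero, Complex.exp_zero, mul_one] at h4
    rw [← h4, mul_assoc, ← Complex.exp_add, neg_add_cancel, Complex.exp_zero, mul_one]
  have h1 : Complex.exp (a * θ.ω) = 1 := by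
    have := h 0
    rw [zero_add, hexp θ.ω] at this
    exact mul_left_cancel₀ (hf0 0) (this.trans (mul_one _).symm)
  have h2 : κ = Complex.exp (a * θ.ω') := by
    have := h' 0
    rw [zero_add, hexp θ.ω', mul_comm] at this
    exact (mul_right_cancel₀ (hf0 0) this).symm
  obtain ⟨m, hm⟩ := Complex.exp_eq_one_iff.1 h1
  refine ⟨m, ?_⟩
  rw [h2, eq_div_of_mul_eq θ.ω_ne_zero hm]
  congr 1
  ring

/-! ### The group `K(Ξ_g)` -/

/-- A shift of one coordinate affects exactly two factors: that of the coordinate and that of the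
sum. -/
theorem ThetaFunction.xi_add_single (θ : ThetaFunction L) {w : ℂ} {J : ℂ → ℂ}
    (h : ∀ z, θ.toFun (z + w) = J z * θ.toFun z) (z : Fin g → ℂ) (i : Fin g) :
    θ.xi g (z + Pi.single i w) = J (z i) * J (∑ j, z j) * θ.xi g z := by
  have h1 : ∀ j, θ.toFun ((z + Pi.single i w : Fin g → ℂ) j) =
      (if j = i then J (z i) else 1) * θ.toFun (z j) := fun j => by
    by_cases hj : j = i
    · subst hj; simp [h]
    · simp [hj]
  have h2 : ∑ j, (z + Pi.single i w : Fin g → ℂ) j = ∑ j, z j + w := by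
    simp [Finset.sum_add_distrib]
  simp only [ThetaFunction.xi, h1, h2, h, Finset.prod_mul_distrib, Finset.prod_ite_eq',
    Finset.mem_univ, if_true]
  ring

theorem ThetaFunction.xi_add_single_ω (θ : ThetaFunction L) (z : Fin g → ℂ) (i : Fin g) :
    θ.xi g (z + Pi.single i θ.ω) = θ.xi g z := by
  rw [θ.xi_add_single (J := fun _ => 1) (fun z => by rw [θ.add_ω, one_mul])]
  ring

theorem ThetaFunction.xi_add_single_ω' (θ : ThetaFunction L) (z : Fin g → ℂ) (i : Fin g) :
    θ.xi g (z + Pi.single i θ.ω') =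
      Complex.exp (-(2 * Real.pi * Complex.I * (z i + ∑ j, z j) / θ.ω)) * θ.xi g z := by
  rw [θ.xi_add_single θ.add_ω', neg_mul_neg, ← Complex.exp_add]
  congr 2
  ring

theorem proj_single {w : ℂ} (hw : w ∈ L.lattice) (i : Fin g) :
    proj L g (Pi.single i w) = 0 := by
  rw [proj_eq_zero_iff]
  intro j
  by_cases hj : j = i
  · subst hj; simpa using hw
  · simp [hj]

theorem ThetaFunction.ω_mem (θ : ThetaFunction L) : θ.ω ∈ L.lattice :=
  (θ.mem_lattice_iff _).2 ⟨1, 0, by simp⟩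

theorem ThetaFunction.ω'_mem (θ : ThetaFunction L) : θ.ω' ∈ L.lattice :=
  (θ.mem_lattice_iff _).2 ⟨0, 1, by simp⟩

/-- Equality of the exponentials means a - mω' ∈ ℤω. This turns a condition on multipliers into
membership in the lattice. -/
theorem ThetaFunction.exp_eq_iff (θ : ThetaFunction L) (a : ℂ) :
    (∃ m : ℤ, Complex.exp (2 * Real.pi * Complex.I * a / θ.ω) =
      Complex.exp (2 * Real.pi * Complex.I * (m * θ.ω' / θ.ω))) ↔ a ∈ L.lattice := by
  have hω := θ.ω_ne_zero
  have hpi : (2 * Real.pi * Complex.I : ℂ) ≠ 0 := Complex.two_pi_I_ne_zero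
  rw [θ.mem_lattice_iff, exists_comm]
  refine exists_congr fun m => ?_
  rw [Complex.exp_eq_exp_iff_exists_int]
  refine exists_congr fun n => ?_
  constructor
  · intro h
    have h1 : 2 * Real.pi * Complex.I * a = 2 * Real.pi * Complex.I * (n * θ.ω + m * θ.ω') := by
      calc 2 * Real.pi * Complex.I * a = 2 * Real.pi * Complex.I * a / θ.ω * θ.ω := by
            field_simp
        _ = _ := by rw [h]; field_simp; ring
    exact mul_left_cancel₀ hpi h1
  · rintro rfl
    field_simp
    ring

/-- Under ω' e_i the quotient ξ(z + c)/ξ(z) picks up exp(-2πi(c_i + ∑ c_j)/ω), so E has the inverse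
multiplier. Restricting E to the i-th axis brings in the classification of multipliers in one
variable. -/
theorem ThetaFunction.add_sum_mem_of_mem_K (θ : ThetaFunction L) (hg : 1 ≤ g) {c : Fin g → ℂ}
    (hc : proj L g c ∈ K (Xi L g)) (i : Fin g) : c i + ∑ j, c j ∈ L.lattice := by
  have hP := θ.isPresentation_Xi hg
  have hΘ := θ.isThetaLike_xi (g := g) hg
  obtain ⟨E, hE, hE0, hper⟩ := (hP.pullback c).exists_of_isomorphic hP (hΘ.comp_add c) hΘ hc
  have hD := (hΘ.comp_add c).dense_inter hΘ
  have hadd : ∀ l, ContinuousOn (fun z => E (z + l)) univ := fun l =>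
    (hE.continuous.comp (continuous_add_const l)).continuousOn
  have hω : ∀ z, E (z + Pi.single i θ.ω) = E z := by
    have := eqOn_of_dense (W := univ) hD isOpen_univ (f := fun z => E (z + Pi.single i θ.ω))
      (k := E) (hadd (Pi.single i θ.ω)) hE.continuous.continuousOn
      fun z _ hz => by
        have h1 := hper z _ (proj_single θ.ω_mem i)
        rw [add_right_comm z, θ.xi_add_single_ω, θ.xi_add_single_ω] at h1
        exact mul_right_cancel₀ hz.1 (mul_right_cancel₀ hz.2 h1)
    exact fun z => this z trivial
  set κ := Complex.exp (2 * Real.pi * Complex.I * (c i + ∑ j, c j) / θ.ω) with hκ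
  have hω' : ∀ z, E (z + Pi.single i θ.ω') = κ * E z := by
    have := eqOn_of_dense (W := univ) hD isOpen_univ (f := fun z => E (z + Pi.single i θ.ω'))
      (k := fun z => κ * E z) (hadd (Pi.single i θ.ω'))
      (continuous_const.mul hE.continuous).continuousOn fun z _ hz => by
        have h1 := hper z _ (proj_single θ.ω'_mem i)
        rw [add_right_comm z, θ.xi_add_single_ω', θ.xi_add_single_ω'] at h1
        have h2 : Complex.exp (-(2 * Real.pi * Complex.I * (z i + ∑ j, z j) / θ.ω)) =
            κ * Complex.exp (-(2 * Real.pi * Complex.I *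
              ((z + c) i + ∑ j, (z + c) j) / θ.ω)) := by
          rw [hκ, ← Complex.exp_add]
          congr 1
          simp only [Pi.add_apply, Finset.sum_add_distrib]
          ring
        rw [h2] at h1
        refine mul_right_cancel₀ hz.1 (mul_right_cancel₀ hz.2 ?_)
        refine mul_left_cancel₀ (Complex.exp_ne_zero (-(2 * Real.pi * Complex.I *
              ((z + c) i + ∑ j, (z + c) j) / θ.ω))) ?_
        linear_combination h1
    exact fun z => this z trivial
  have hs : ∀ w w' : ℂ, (Pi.single i (w + w') : Fin g → ℂ) = Pi.single i w + Pi.single i w' :=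
    fun w w' => Pi.single_add (f := fun _ => ℂ) i w w'
  have hEi : Differentiable ℂ fun w : ℂ => E (Pi.single i w) :=
    hE.comp (ContinuousLinearMap.single ℂ (fun _ : Fin g => ℂ) i).differentiable
  exact (θ.exp_eq_iff _).1 (θ.exists_multiplier_eq hEi
    (fun w => hE0 _) (fun w => by rw [hs, hω]) (fun w => by rw [hs, hω']))

/-- If (g + 1)c = nω + mω', then exp(2πi m ∑ z_j/ω) serves as E. A single m works for every
coordinate direction because c_i + ∑ c_j = (g + 1)c does not depend on i. -/
theorem ThetaFunction.const_mem_K (θ : ThetaFunction L) (hg : 1 ≤ g) {c : ℂ}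
    (hc : (g + 1) * c ∈ L.lattice) : proj L g (fun _ => c) ∈ K (Xi L g) := by
  have hP := θ.isPresentation_Xi hg
  have hΘ := θ.isThetaLike_xi (g := g) hg
  obtain ⟨m, hm⟩ := (θ.exp_eq_iff _).2 hc
  have hω0 := θ.ω_ne_zero
  set Θ₁ : (Fin g → ℂ) → ℂ := fun z => θ.xi g (z + fun _ => c) with hΘ₁def
  have hΘ₁ : IsThetaLike L Θ₁ := hΘ.comp_add _
  set E : (Fin g → ℂ) → ℂ := fun z =>
    Complex.exp (2 * Real.pi * Complex.I * (m * (∑ j, z j) / θ.ω)) with hE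
  let S : AddSubgroup (Fin g → ℂ) :=
    { carrier := {l | ∀ z, E (z + l) * Θ₁ (z + l) / θ.xi g (z + l) = E z * Θ₁ z / θ.xi g z}
      zero_mem' := fun z => by rw [add_zero]
      add_mem' := fun {l l'} hl hl' z => by rw [← add_assoc, hl', hl]
      neg_mem' := fun {l} hl z => by rw [← hl (z + -l), neg_add_cancel_right] }
  have hEs : ∀ z i w, E (z + Pi.single i w) =
      Complex.exp (2 * Real.pi * Complex.I * (m * w / θ.ω)) * E z := fun z i w => by
    simp only [hE, ← Complex.exp_add, Pi.add_apply, Finset.sum_add_distrib, Finset.sum_pi_single',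
      Finset.mem_univ, if_true]
    congr 1
    ring
  have hω : ∀ i, Pi.single i θ.ω ∈ S := fun i z => by
    have h1 : Complex.exp (2 * Real.pi * Complex.I * (m * θ.ω / θ.ω)) = 1 := by
      rw [mul_div_cancel_right₀ _ hω0, mul_comm, Complex.exp_int_mul_two_pi_mul_I]
    simp only [hΘ₁def]
    rw [hEs, h1, add_right_comm z, θ.xi_add_single_ω, θ.xi_add_single_ω, one_mul]
  have hω' : ∀ i, Pi.single i θ.ω' ∈ S := fun i z => by
    have h2 : Complex.exp (-(2 * Real.pi * Complex.I * (z i + ∑ j, z j) / θ.ω)) =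
        Complex.exp (2 * Real.pi * Complex.I * (m * θ.ω' / θ.ω)) *
          Complex.exp (-(2 * Real.pi * Complex.I *
            ((z + fun _ => c : Fin g → ℂ) i + ∑ j, (z + fun _ => c : Fin g → ℂ) j) / θ.ω)) := by
      rw [← hm, ← Complex.exp_add]
      congr 1
      simp only [Pi.add_apply, Finset.sum_add_distrib, Finset.sum_const, Finset.card_univ,
        Fintype.card_fin, nsmul_eq_mul]
      ring
    simp only [hΘ₁def]
    rw [hEs, add_right_comm z, θ.xi_add_single_ω', θ.xi_add_single_ω', h2]
    have h3 := Complex.exp_ne_zero (2 * Real.pi * Complex.I * (m * θ.ω' / θ.ω))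
    have h4 := Complex.exp_ne_zero (-(2 * Real.pi * Complex.I *
      ((z + fun _ => c : Fin g → ℂ) i + ∑ j, (z + fun _ => c : Fin g → ℂ) j) / θ.ω))
    rw [← mul_div_mul_left _ (θ.xi g z) (mul_ne_zero h3 h4)]
    congr 1
    ring
  -- The vectors ω e_i and ω' e_i generate all periods, and `S` is a subgroup.
  have hS : ∀ l, proj L g l = 0 → l ∈ S := fun l hl => by
    rw [← Finset.univ_sum_single l]
    refine S.sum_mem fun i _ => ?_
    obtain ⟨a, b, hab⟩ := (θ.mem_lattice_iff _).1 (proj_eq_zero_iff.1 hl i)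
    have h1 := S.add_mem (S.zsmul_mem (hω i) a) (S.zsmul_mem (hω' i) b)
    rw [← Pi.single_smul, ← Pi.single_smul, ← Pi.single_add, zsmul_eq_mul, zsmul_eq_mul,
      ← hab] at h1
    exact h1
  have hEd : Differentiable ℂ E := by
    simp only [hE]
    fun_prop
  refine (hP.pullback fun _ => c).isomorphic hP hΘ₁ hΘ hEd (fun z => Complex.exp_ne_zero _)
    fun z l hl => ?_
  have hpl : proj L g (z + l) = proj L g z := by rw [proj_add, hl, add_zero]
  have h1 := hΘ.eq_zero_iff_of_proj_eq hpl
  by_cases hz : θ.xi g z = 0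
  · rw [hz, h1.2 hz, mul_zero, mul_zero]
  · exact (div_eq_div_iff (fun h => hz (h1.1 h)) hz).1 (hS l hl z)

/-- The relations x_i + ∑ x_j = 0 force all coordinates to equal t = -∑ x_j, and then ∑ x_j = gt
gives (g + 1)t = 0. -/
theorem mem_K_Xi_iff (hg : 1 ≤ g) (x : Pow L g) :
    x ∈ K (Xi L g) ↔ ∃ t : Curve L, (g + 1) • t = 0 ∧ x = fun _ => t := by
  obtain ⟨θ⟩ := nonempty_thetaFunction L
  have hnsmul : ∀ c : ℂ, (g + 1) • L.lattice.mkQ c = 0 ↔ (g + 1) * c ∈ L.lattice := fun c => by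
    rw [← map_nsmul, mkQ_eq_zero_iff, nsmul_eq_mul]
    push_cast
    rfl
  constructor
  · intro hx
    obtain ⟨c, rfl⟩ := proj_surjective x
    have h1 := θ.add_sum_mem_of_mem_K hg hx
    have h2 : ∀ i, L.lattice.mkQ (c i) = -∑ j, L.lattice.mkQ (c j) := fun i => by
      have := mkQ_eq_zero_iff.2 (h1 i)
      rw [map_add, map_sum] at this
      exact eq_neg_of_add_eq_zero_left this
    refine ⟨-∑ j, L.lattice.mkQ (c j), ?_, funext h2⟩
    have h3 : ∑ j, L.lattice.mkQ (c j) = g • -∑ j, L.lattice.mkQ (c j) := by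
      conv_lhs => rw [Finset.sum_congr rfl fun i _ => h2 i]
      simp
    rw [succ_nsmul, ← h3, add_neg_cancel]
  · rintro ⟨t, ht, rfl⟩
    obtain ⟨c, rfl⟩ := L.lattice.mkQ_surjective t
    exact θ.const_mem_K hg ((hnsmul c).1 ht)

/-! ### Torsion points of the elliptic curve -/

/-- The group of `n`-torsion points of a complex elliptic curve is `ℤ / n × ℤ / n`. -/
theorem nonempty_torsion_addEquiv (L : PeriodPair) (n : ℕ) [NeZero n] :
    Nonempty ((nsmulAddMonoidHom (α := Curve L) n).ker ≃+ ZMod n × ZMod n) := by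
  have hn : (n : ℂ) ≠ 0 := Nat.cast_ne_zero.2 (NeZero.ne n)
  -- Division of the lattice by `n` and reduction modulo `n` are surjections from ℤ² with the same
  -- kernel nℤ², so their images are isomorphic.
  let f : ℤ × ℤ →+ (nsmulAddMonoidHom (α := Curve L) n).ker :=
    { toFun := fun p => ⟨L.lattice.mkQ ((p.1 * L.ω₁ + p.2 * L.ω₂) / n), by
        rw [AddMonoidHom.mem_ker, nsmulAddMonoidHom_apply, ← map_nsmul, mkQ_eq_zero_iff,
          nsmul_eq_mul, mul_div_cancel₀ _ hn]
        exact PeriodPair.mem_lattice.2 ⟨p.1, p.2, rfl⟩⟩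
      map_zero' := Subtype.ext (by simp)
      map_add' := fun p q => Subtype.ext (by
        simp only [AddSubgroup.coe_add, ← map_add, Prod.fst_add, Prod.snd_add]
        congr 1
        push_cast
        ring) }
  let k : ℤ × ℤ →+ ZMod n × ZMod n :=
    (Int.castAddHom (ZMod n)).prodMap (Int.castAddHom (ZMod n))
  have hf : Function.Surjective f := by
    rintro ⟨t, ht⟩
    obtain ⟨c, rfl⟩ := L.lattice.mkQ_surjective t
    rw [AddMonoidHom.mem_ker, nsmulAddMonoidHom_apply, ← map_nsmul, mkQ_eq_zero_iff,
      nsmul_eq_mul] at ht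
    obtain ⟨a, b, hab⟩ := PeriodPair.mem_lattice.1 ht
    refine ⟨(a, b), Subtype.ext ?_⟩
    change L.lattice.mkQ ((a * L.ω₁ + b * L.ω₂) / n) = _
    rw [hab, mul_div_cancel_left₀ _ hn]
  have hk : Function.Surjective k := by
    rintro ⟨a, b⟩
    obtain ⟨a, rfl⟩ := ZMod.intCast_surjective a
    obtain ⟨b, rfl⟩ := ZMod.intCast_surjective b
    exact ⟨(a, b), rfl⟩
  have hker : f.ker = k.ker := by
    ext ⟨a, b⟩
    have h1 : (a, b) ∈ k.ker ↔ (n : ℤ) ∣ a ∧ (n : ℤ) ∣ b := by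
      rw [AddMonoidHom.mem_ker, ← ZMod.intCast_zmod_eq_zero_iff_dvd,
        ← ZMod.intCast_zmod_eq_zero_iff_dvd]
      exact Prod.mk_eq_zero
    have h2 : (a, b) ∈ f.ker ↔ (a * L.ω₁ + b * L.ω₂) / n ∈ L.lattice := by
      rw [AddMonoidHom.mem_ker, ← mkQ_eq_zero_iff]
      exact Subtype.ext_iff
    rw [h1, h2, PeriodPair.mem_lattice]
    constructor
    · rintro ⟨p, q, hpq⟩
      rw [eq_div_iff hn] at hpq
      have h3 := LinearIndependent.pair_iff.1 L.indep (n * p - a) (n * q - b) (by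
        simp only [Complex.real_smul]
        push_cast
        linear_combination hpq)
      constructor
      · exact ⟨p, by have := h3.1; rw [sub_eq_zero] at this; exact_mod_cast this.symm⟩
      · exact ⟨q, by have := h3.2; rw [sub_eq_zero] at this; exact_mod_cast this.symm⟩
    · rintro ⟨⟨p, rfl⟩, ⟨q, rfl⟩⟩
      refine ⟨p, q, ?_⟩
      push_cast
      field_simp
  exact ⟨(QuotientAddGroup.quotientKerEquivOfSurjective f hf).symm.trans
    ((QuotientAddGroup.quotientAddEquivOfEq hker).trans
      (QuotientAddGroup.quotientKerEquivOfSurjective k hk))⟩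

theorem nonempty_K_Xi_addEquiv (hg : 1 ≤ g) :
    Nonempty (K (Xi L g) ≃+ (nsmulAddMonoidHom (α := Curve L) (g + 1)).ker) := by
  have hmem := mem_K_Xi_iff (L := L) hg
  refine ⟨
    { toFun := fun x => ⟨x.1 ⟨0, hg⟩, ?_⟩
      invFun := fun t => ⟨fun _ => t.1, (hmem _).2 ⟨t.1, t.2, rfl⟩⟩
      left_inv := fun x => ?_
      right_inv := fun t => rfl
      map_add' := fun _ _ => rfl }⟩
  · obtain ⟨t, ht, hx⟩ := (hmem _).1 x.2
    rw [hx]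
    exact ht
  · obtain ⟨t, ht, hx⟩ := (hmem _).1 x.2
    refine Subtype.ext ?_
    simp only [hx]

/-- `⨁ ℤ / d_i` for `d = (1, …, 1, g + 1)`. -/
theorem nonempty_pi_zmod_addEquiv (hg : 1 ≤ g) (n : ℕ) :
    Nonempty ((∀ i : Fin g, ZMod (if (i : ℕ) + 1 = g then n else 1)) ≃+ ZMod n) := by
  obtain ⟨k, rfl⟩ : ∃ k, g = k + 1 := ⟨g - 1, by omega⟩
  have hlast : (if ((Fin.last k : Fin (k + 1)) : ℕ) + 1 = k + 1 then n else 1) = n := by simp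
  let φ : (∀ i : Fin (k + 1), ZMod (if (i : ℕ) + 1 = k + 1 then n else 1)) →+
      ZMod (if ((Fin.last k : Fin (k + 1)) : ℕ) + 1 = k + 1 then n else 1) :=
    Pi.evalAddMonoidHom _ (Fin.last k)
  have hφ : Function.Bijective φ := by
    constructor
    · intro x y hxy
      funext i
      by_cases hi : i = Fin.last k
      · subst hi; exact hxy
      · have h1 : ¬ (i : ℕ) + 1 = k + 1 := fun h => hi (Fin.ext (by simpa using h))
        have : Subsingleton (ZMod (if (i : ℕ) + 1 = k + 1 then n else 1)) := by
          rw [if_neg h1]; infer_instance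
        exact Subsingleton.elim _ _
    · exact Function.surjective_eval (Fin.last k)
  exact ⟨(AddEquiv.ofBijective φ hφ).trans (ZMod.ringEquivCongr hlast).toAddEquiv⟩

theorem hasType_Xi (hg : 1 ≤ g) :
    HasType (Xi L g) fun i => if (i : ℕ) + 1 = g then g + 1 else 1 := by
  refine ⟨fun i => by dsimp only; split_ifs <;> omega, fun i j hij => ?_, ?_⟩
  · by_cases hi : (i : ℕ) + 1 = g
    · have hj : (j : ℕ) + 1 = g := by
        have := j.2
        have : (i : ℕ) ≤ j := hij
        omega
      simp [hi, hj]
    · simp [hi]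
  · obtain ⟨e₁⟩ := nonempty_K_Xi_addEquiv (L := L) hg
    obtain ⟨e₂⟩ := nonempty_torsion_addEquiv L (g + 1)
    obtain ⟨e₃⟩ := nonempty_pi_zmod_addEquiv hg (g + 1)
    exact ⟨(e₁.trans e₂).trans (AddEquiv.prodCongr e₃.symm e₃.symm)⟩

end EllPow

end

theorem lemma3p3 (L : PeriodPair) (g : ℕ) (hg : 1 ≤ g) :
    (EllPow.K (EllPow.Xi L g) : Set (EllPow.Pow L g)) =
        {x | ∃ t : EllPow.Curve L, (g + 1) • t = 0 ∧ x = fun _ => t} ∧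
      {x : EllPow.sumZero L g | EllPow.sumZeroEquiv L g x ∈ EllPow.K (EllPow.Xi L g)} =
        {x : EllPow.sumZero L g | ∃ t : EllPow.Curve L, (g + 1) • t = 0 ∧ (x : EllPow.Pow L (g + 1)) = fun _ => t} ∧
      EllPow.HasType (EllPow.Xi L g) (fun i => if (i : ℕ) + 1 = g then g + 1 else 1) := by
  refine ⟨Set.ext fun x => EllPow.mem_K_Xi_iff hg x, Set.ext fun x => ?_, EllPow.hasType_Xi hg⟩
  rw [Set.mem_ofPred_eq, Set.mem_ofPred_eq, EllPow.mem_K_Xi_iff hg]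
  refine exists_congr fun t => and_congr_right fun ht => ?_
  rw [← AddEquiv.eq_symm_apply, Subtype.ext_iff, eq_comm (a := (x : EllPow.Pow L (g + 1)))]
  -- The restored last coordinate is -gt, which equals t because (g + 1)t = 0.
  have h : (((EllPow.sumZeroEquiv L g).symm fun _ => t : EllPow.sumZero L g) :
      EllPow.Pow L (g + 1)) = fun _ => t := by
    funext i
    refine Fin.lastCases ?_ (fun j => ?_) i
    · change Fin.snoc (α := fun _ => EllPow.Curve L) (fun _ => t) (-∑ i : Fin g, t) (Fin.last g) = t
      rw [Fin.snoc_last, Finset.sum_const, Finset.card_univ, Fintype.card_fin]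
      rw [succ_nsmul] at ht
      exact neg_eq_of_add_eq_zero_right ht
    · change Fin.snoc (α := fun _ => EllPow.Curve L) (fun _ => t) (-∑ i : Fin g, t) j.castSucc = t
      rw [Fin.snoc_castSucc]
  rw [h, eq_comm]
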